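/- All Hilbert spaces are complex, and $[S]$ denotes the norm closed linear span of a set $S$. Let $K_1,K_2,H_1,H_2$ be Hilbert spaces, and let $X\subseteq B(K_1,K_2)$ and $Y\subseteq B(H_1,H_2)$ be operator spaces (norm closed subspaces) that are strongly TRO equivalent by $M_1\subseteq B(H_1,K_1)$ and $M_2\subseteq B(H_2,K_2)$; that is, $M_1,M_2$ are norm closed subspaces with $M_iM_i^*M_i\subseteq M_i$ for $i=1,2$, and $X=[M_2YM_1^*]$, $Y=[M_2^*XM_1]$. Put $$A=[M_2M_2^*],\quad B=[M_1M_1^*],\quad C=[M_2^*M_2],\quad D=[M_1^*M_1].$$ These are C*-algebras, and operator multiplication makes $X$ an $A$-$B$-bimodule ${}_AX_B$ and $Y$ a $C$-$D$-bimodule ${}_CY_D$. A completely contractive bimodule map $(\pi,\phi,\sigma)\colon {}_AX_B\to B(L_1,L_2)$, with $L_1,L_2$ Hilbert spaces, consists of $*$-representations $\pi\colon A\to B(L_2)$ and $\sigma\colon B\to B(L_1)$ and a completely contractive linear map $\phi\colon X\to B(L_1,L_2)$ such that $\phi(ax)=\pi(a)\phi(x)$ and $\phi(xb)=\phi(x)\sigma(b)$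 for all $a\in A$, $x\in X$, $b\in B$. It is non-degenerate if $[\pi(A)L_2]=L_2$, $[\sigma(B)L_1]=L_1$, $[\phi(X)L_1]=L_2$ and $[\phi(X)^*L_2]=L_1$. It is a faithful CES representation if $\phi$ is completely isometric and $\pi,\sigma$ are injective. Two such maps $(\pi,\phi,\sigma)$ and $(\pi',\phi',\sigma')$ are unitarily equivalent if there are unitaries $U\colon L_2\to L_2'$ and $V\colon L_1\to L_1'$ with $\pi'=U\pi(\cdot)U^*$, $\phi'=U\phi(\cdot)V^*$ and $\sigma'=V\sigma(\cdot)V^*$. The same definitions apply to ${}_CY_D$. Then there is a bijection between the unitary equivalence classes of non-degenerate completely contractive bimodule maps of ${}_AX_B$ and the unitary equivalence classes of non-degenerate completely contractive bimodule maps of ${}_CY_D$. Under it the class of $(\pi,\phi,\sigma)\colon{}_AX_B\to B(L_1,L_2)$ is sent to the class of $(\rho,\psi,\tau)\colon{}_CY_D\to B(L_1',L_2')$ if and only if there are linear maps $s\colon M_1\to B(L_1',L_1)$ and $t\colon M_2\to B(L_2',L_2)$ such that $$s(m)s(n)^*=\sigma(mn^*),\quad s(m)^*s(n)=\tau(m^*n)\quad(m,n\in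 M_1),$$ $$t(m)t(n)^*=\pi(mn^*),\quad t(m)^*t(n)=\rho(m^*n)\quad(m,n\in M_2),$$ $$\psi(n^*xm)=t(n)^*\phi(x)s(m)\quad(n\in M_2,\ x\in X,\ m\in M_1).$$ Moreover, if the class of $(\pi,\phi,\sigma)$ is sent to the class of $(\rho,\psi,\tau)$, then $(\pi,\phi,\sigma)$ is a faithful CES representation if and only if $(\rho,\psi,\tau)$ is one. -/

import Mathlib

universe u

open scoped InnerProduct

namespace StrongTRO

section General

variable {E F G : Type*}
  [NormedAddCommGroup E] [InnerProductSpace ℂ E]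
  [NormedAddCommGroup F] [InnerProductSpace ℂ F]
  [NormedAddCommGroup G] [InnerProductSpace ℂ G]

/-- The norm closed linear span of a set. -/
def ncl {V : Type*} [SeminormedAddCommGroup V] [NormedSpace ℂ V] (S : Set V) : Submodule ℂ V :=
  (Submodule.span ℂ S).topologicalClosure

theorem subset_ncl {V : Type*} [SeminormedAddCommGroup V] [NormedSpace ℂ V] {S : Set V} {v : V}
    (hv : v ∈ S) : v ∈ ncl S :=
  Submodule.le_topologicalClosure _ (Submodule.subset_span hv)

theorem isClosed_ncl {V : Type*} [SeminormedAddCommGroup V] [NormedSpace ℂ V] (S : Set V) :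
    IsClosed (ncl S : Set V) :=
  Submodule.isClosed_topologicalClosure _

theorem ncl_le {V : Type*} [SeminormedAddCommGroup V] [NormedSpace ℂ V] {S : Set V}
    {U : Submodule ℂ V} (hU : IsClosed (U : Set V)) (h : ∀ v ∈ S, v ∈ U) : ncl S ≤ U :=
  Submodule.topologicalClosure_minimal _ (Submodule.span_le.2 h) hU

theorem comp_mem_of_ncl {S : Set (F →L[ℂ] G)} {T : Set (E →L[ℂ] F)}
    {U : Submodule ℂ (E →L[ℂ] G)} (hU : IsClosed (U : Set (E →L[ℂ] G)))
    (h : ∀ s ∈ S, ∀ t ∈ T, s ∘L t ∈ U) {s : F →L[ℂ] G} {t : E →L[ℂ] F}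
    (hs : s ∈ ncl S) (ht : t ∈ ncl T) : s ∘L t ∈ U := by
  have h1 : ∀ s ∈ S, ncl T ≤ U.comap ((ContinuousLinearMap.compL ℂ E F G s) :
      (E →L[ℂ] F) →ₗ[ℂ] (E →L[ℂ] G)) := fun s hs =>
    ncl_le (hU.preimage (ContinuousLinearMap.compL ℂ E F G s).continuous) fun t ht => h s hs t ht
  have h2 : ncl S ≤ U.comap (((ContinuousLinearMap.compL ℂ E F G).flip t) :
      (F →L[ℂ] G) →ₗ[ℂ] (E →L[ℂ] G)) :=
    ncl_le (hU.preimage ((ContinuousLinearMap.compL ℂ E F G).flip t).continuous)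
      fun s hs => h1 s hs ht
  exact h2 hs

/-- The operator `E ^ n → F ^ n` (Hilbert space direct sums) of an `n × n` matrix of operators. -/
noncomputable def opMatrix {n : ℕ} (x : Fin n → Fin n → (E →L[ℂ] F)) :
    PiLp 2 (fun _ : Fin n => E) →L[ℂ] PiLp 2 (fun _ : Fin n => F) :=
  ((PiLp.continuousLinearEquiv 2 ℂ (fun _ : Fin n => F)).symm :
      (Fin n → F) →L[ℂ] PiLp 2 (fun _ : Fin n => F)) ∘L
    ContinuousLinearMap.pi fun i => ∑ j, x i j ∘L PiLp.proj 2 (fun _ : Fin n => E) j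

theorem opMatrix_apply {n : ℕ} (x : Fin n → Fin n → (E →L[ℂ] F))
    (ξ : PiLp 2 (fun _ : Fin n => E)) (i : Fin n) : opMatrix x ξ i = ∑ j, x i j (ξ j) := by
  simp [opMatrix]

variable {E' F' : Type*}
  [NormedAddCommGroup E'] [InnerProductSpace ℂ E']
  [NormedAddCommGroup F'] [InnerProductSpace ℂ F']

/-- `φ` is completely contractive: each amplification `Mₙ(X) → Mₙ(B(E', F'))` is contractive. -/
def CompletelyContractive {X : Submodule ℂ (E →L[ℂ] F)} (φ : X →ₗ[ℂ] (E' →L[ℂ] F')) : Prop :=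
  ∀ (n : ℕ) (x : Fin n → Fin n → X),
    ‖opMatrix fun i j => φ (x i j)‖ ≤ ‖opMatrix fun i j => (x i j : E →L[ℂ] F)‖

/-- `φ` is completely isometric: each amplification `Mₙ(X) → Mₙ(B(E', F'))` is isometric. -/
def CompletelyIsometric {X : Submodule ℂ (E →L[ℂ] F)} (φ : X →ₗ[ℂ] (E' →L[ℂ] F')) : Prop :=
  ∀ (n : ℕ) (x : Fin n → Fin n → X),
    ‖opMatrix fun i j => φ (x i j)‖ = ‖opMatrix fun i j => (x i j : E →L[ℂ] F)‖

end General

section TRO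

variable {H K : Type*}
  [NormedAddCommGroup H] [InnerProductSpace ℂ H] [CompleteSpace H]
  [NormedAddCommGroup K] [InnerProductSpace ℂ K] [CompleteSpace K]

/-- A ternary ring of operators: a norm closed subspace `M` of `B(H, K)` with `M M* M ⊆ M`. -/
structure IsTRO (M : Submodule ℂ (H →L[ℂ] K)) : Prop where
  isClosed : IsClosed (M : Set (H →L[ℂ] K))
  ternary : ∀ m ∈ M, ∀ n ∈ M, ∀ p ∈ M, m ∘L n† ∘L p ∈ M

/-- The set of products `m n*` with `m, n ∈ M`. -/
def leftProducts (M : Submodule ℂ (H →L[ℂ] K)) : Set (K →L[ℂ] K) :=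
  {T | ∃ m ∈ M, ∃ n ∈ M, T = m ∘L n†}

/-- The set of products `m* n` with `m, n ∈ M`. -/
def rightProducts (M : Submodule ℂ (H →L[ℂ] K)) : Set (H →L[ℂ] H) :=
  {T | ∃ m ∈ M, ∃ n ∈ M, T = m† ∘L n}

theorem star_mem_ncl {S : Set (K →L[ℂ] K)} (h : ∀ s ∈ S, star s ∈ S) {T : K →L[ℂ] K}
    (hT : T ∈ ncl S) : star T ∈ ncl S := by
  have hc : IsClosed {T : K →L[ℂ] K | star T ∈ ncl S} := (isClosed_ncl S).preimage continuous_star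
  let U : Submodule ℂ (K →L[ℂ] K) :=
    { carrier := {T | star T ∈ ncl S}
      add_mem' := fun {a b} ha hb => by
        simpa only [Set.mem_ofPred_eq, star_add] using (ncl S).add_mem ha hb
      zero_mem' := by simp
      smul_mem' := fun c a ha => by
        simpa only [Set.mem_ofPred_eq, star_smul] using (ncl S).smul_mem _ ha }
  exact ncl_le (U := U) hc (fun s hs => subset_ncl (h s hs)) hT

/-- The C*-algebra `[M M*]⁻ ⊆ B(K)` of a TRO `M ⊆ B(H, K)`. -/
noncomputable def leftAlg (M : Submodule ℂ (H →L[ℂ] K)) (hM : IsTRO M) :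
    NonUnitalStarSubalgebra ℂ (K →L[ℂ] K) :=
  { ncl (leftProducts M) with
    mul_mem' := fun {a b} ha hb => by
      refine comp_mem_of_ncl (isClosed_ncl _) ?_ ha hb
      rintro _ ⟨m, hm, n, hn, rfl⟩ _ ⟨p, hp, q, hq, rfl⟩
      exact subset_ncl ⟨m ∘L n† ∘L p, hM.ternary m hm n hn p hp, q, hq, rfl⟩
    star_mem' := fun {a} ha => by
      refine star_mem_ncl ?_ ha
      rintro _ ⟨m, hm, n, hn, rfl⟩
      refine ⟨n, hn, m, hm, ?_⟩
      simp [ContinuousLinearMap.star_eq_adjoint, ContinuousLinearMap.adjoint_comp] }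

/-- The C*-algebra `[M* M]⁻ ⊆ B(H)` of a TRO `M ⊆ B(H, K)`. -/
noncomputable def rightAlg (M : Submodule ℂ (H →L[ℂ] K)) (hM : IsTRO M) :
    NonUnitalStarSubalgebra ℂ (H →L[ℂ] H) :=
  { ncl (rightProducts M) with
    mul_mem' := fun {a b} ha hb => by
      refine comp_mem_of_ncl (isClosed_ncl _) ?_ ha hb
      rintro _ ⟨m, hm, n, hn, rfl⟩ _ ⟨p, hp, q, hq, rfl⟩
      exact subset_ncl ⟨m, hm, n ∘L p† ∘L q, hM.ternary n hn p hp q hq, rfl⟩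
    star_mem' := fun {a} ha => by
      refine star_mem_ncl ?_ ha
      rintro _ ⟨m, hm, n, hn, rfl⟩
      refine ⟨n, hn, m, hm, ?_⟩
      simp [ContinuousLinearMap.star_eq_adjoint, ContinuousLinearMap.adjoint_comp] }

theorem mem_leftAlg {M : Submodule ℂ (H →L[ℂ] K)} (hM : IsTRO M) {m n : H →L[ℂ] K}
    (hm : m ∈ M) (hn : n ∈ M) : m ∘L n† ∈ leftAlg M hM :=
  subset_ncl (S := leftProducts M) ⟨m, hm, n, hn, rfl⟩

theorem mem_rightAlg {M : Submodule ℂ (H →L[ℂ] K)} (hM : IsTRO M) {m n : H →L[ℂ] K}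
    (hm : m ∈ M) (hn : n ∈ M) : m† ∘L n ∈ rightAlg M hM :=
  subset_ncl (S := rightProducts M) ⟨m, hm, n, hn, rfl⟩

end TRO

section Bimodule

variable {K₁ K₂ : Type u}
  [NormedAddCommGroup K₁] [InnerProductSpace ℂ K₁] [CompleteSpace K₁]
  [NormedAddCommGroup K₂] [InnerProductSpace ℂ K₂] [CompleteSpace K₂]

variable (K₁ K₂) in
/-- A (concrete) C*-bimodule: an operator space `X ⊆ B(K₁, K₂)` together with C*-algebras
`A ⊆ B(K₂)` and `B ⊆ B(K₁)` acting on it by composition of operators. -/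
structure CStarBimodule where
  A : NonUnitalStarSubalgebra ℂ (K₂ →L[ℂ] K₂)
  X : Submodule ℂ (K₁ →L[ℂ] K₂)
  B : NonUnitalStarSubalgebra ℂ (K₁ →L[ℂ] K₁)
  isClosed_A : IsClosed (A : Set (K₂ →L[ℂ] K₂))
  isClosed_X : IsClosed (X : Set (K₁ →L[ℂ] K₂))
  isClosed_B : IsClosed (B : Set (K₁ →L[ℂ] K₁))
  left_mem : ∀ a ∈ A, ∀ x ∈ X, a ∘L x ∈ X
  right_mem : ∀ x ∈ X, ∀ b ∈ B, x ∘L b ∈ X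

/-- A completely contractive bimodule map `(π, φ, σ) : _A X_B → B(L₁, L₂)` into some Hilbert
spaces `L₁`, `L₂`: `π` and `σ` are `*`-representations, `φ` is completely contractive and linear,
and `φ (a x) = π(a) φ(x)`, `φ (x b) = φ(x) σ(b)`. -/
structure BimoduleMap (𝓔 : CStarBimodule K₁ K₂) where
  L₁ : Type u
  L₂ : Type u
  [normedAddCommGroup₁ : NormedAddCommGroup L₁]
  [innerProductSpace₁ : InnerProductSpace ℂ L₁]
  [completeSpace₁ : CompleteSpace L₁]
  [normedAddCommGroup₂ : NormedAddCommGroup L₂]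
  [innerProductSpace₂ : InnerProductSpace ℂ L₂]
  [completeSpace₂ : CompleteSpace L₂]
  π : 𝓔.A →⋆ₙₐ[ℂ] (L₂ →L[ℂ] L₂)
  φ : 𝓔.X →ₗ[ℂ] (L₁ →L[ℂ] L₂)
  σ : 𝓔.B →⋆ₙₐ[ℂ] (L₁ →L[ℂ] L₁)
  completelyContractive : CompletelyContractive φ
  map_left : ∀ (a : 𝓔.A) (x : 𝓔.X),
    φ ⟨(a : K₂ →L[ℂ] K₂) ∘L (x : K₁ →L[ℂ] K₂), 𝓔.left_mem a a.2 x x.2⟩ = π a ∘L φ x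
  map_right : ∀ (x : 𝓔.X) (b : 𝓔.B),
    φ ⟨(x : K₁ →L[ℂ] K₂) ∘L (b : K₁ →L[ℂ] K₁), 𝓔.right_mem x x.2 b b.2⟩ = φ x ∘L σ b

attribute [instance] BimoduleMap.normedAddCommGroup₁ BimoduleMap.innerProductSpace₁
  BimoduleMap.completeSpace₁ BimoduleMap.normedAddCommGroup₂ BimoduleMap.innerProductSpace₂
  BimoduleMap.completeSpace₂

variable {𝓔 : CStarBimodule K₁ K₂}

/-- `(π, φ, σ)` is non-degenerate: `[π(A) L₂] = L₂`, `[φ(X) L₁] = L₂`, `[φ(X)* L₂] = L₁` and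
`[σ(B) L₁] = L₁`. -/
structure BimoduleMap.NonDegenerate (r : BimoduleMap 𝓔) : Prop where
  left : ncl {η : r.L₂ | ∃ (a : 𝓔.A) (ξ : r.L₂), η = r.π a ξ} = ⊤
  range : ncl {η : r.L₂ | ∃ (x : 𝓔.X) (ξ : r.L₁), η = r.φ x ξ} = ⊤
  corange : ncl {η : r.L₁ | ∃ (x : 𝓔.X) (ξ : r.L₂), η = ContinuousLinearMap.adjoint (r.φ x) ξ} = ⊤
  right : ncl {η : r.L₁ | ∃ (b : 𝓔.B) (ξ : r.L₁), η = r.σ b ξ} = ⊤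

/-- `(π, φ, σ)` is a faithful CES representation: `φ` is completely isometric, and `π` and `σ` are
faithful. -/
structure BimoduleMap.IsFaithfulCES (r : BimoduleMap 𝓔) : Prop where
  completelyIsometric : CompletelyIsometric r.φ
  left_injective : Function.Injective r.π
  right_injective : Function.Injective r.σ

/-- Unitary equivalence: `(π', φ', σ') = (U π(·) U*, U φ(·) V*, V σ(·) V*)` for unitaries
`U : L₂ → L₂'` and `V : L₁ → L₁'`. -/
def BimoduleMap.UnitarilyEquivalent (r r' : BimoduleMap 𝓔) : Prop :=
  ∃ (V : r.L₁ ≃ₗᵢ[ℂ] r'.L₁) (U : r.L₂ ≃ₗᵢ[ℂ] r'.L₂),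
    (∀ a ξ, r'.π a ξ = U (r.π a (U.symm ξ))) ∧
    (∀ x ξ, r'.φ x ξ = U (r.φ x (V.symm ξ))) ∧
    (∀ b ξ, r'.σ b ξ = V (r.σ b (V.symm ξ)))

theorem BimoduleMap.UnitarilyEquivalent.refl (r : BimoduleMap 𝓔) : r.UnitarilyEquivalent r :=
  ⟨.refl ℂ _, .refl ℂ _, fun _ _ => rfl, fun _ _ => rfl, fun _ _ => rfl⟩

theorem BimoduleMap.UnitarilyEquivalent.symm {r r' : BimoduleMap 𝓔}
    (h : r.UnitarilyEquivalent r') : r'.UnitarilyEquivalent r := by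
  obtain ⟨V, U, hπ, hφ, hσ⟩ := h
  exact ⟨V.symm, U.symm, by simp [hπ], by simp [hφ], by simp [hσ]⟩

theorem BimoduleMap.UnitarilyEquivalent.trans {r r' r'' : BimoduleMap 𝓔}
    (h : r.UnitarilyEquivalent r') (h' : r'.UnitarilyEquivalent r'') :
    r.UnitarilyEquivalent r'' := by
  obtain ⟨V, U, hπ, hφ, hσ⟩ := h
  obtain ⟨V', U', hπ', hφ', hσ'⟩ := h'
  exact ⟨V.trans V', U.trans U', by simp [hπ, hπ'], by simp [hφ, hφ'], by simp [hσ, hσ']⟩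

/-- The non-degenerate completely contractive bimodule maps of a C*-bimodule. -/
def NonDegMap (𝓔 : CStarBimodule K₁ K₂) : Type (u + 1) :=
  {r : BimoduleMap 𝓔 // r.NonDegenerate}

instance unitarySetoid (𝓔 : CStarBimodule K₁ K₂) : Setoid (NonDegMap 𝓔) where
  r r r' := r.1.UnitarilyEquivalent r'.1
  iseqv := ⟨fun r => .refl r.1, fun h => h.symm, fun h h' => h.trans h'⟩

/-- Unitary equivalence classes of non-degenerate completely contractive bimodule maps. -/
def NonDegClass (𝓔 : CStarBimodule K₁ K₂) : Type (u + 1) := Quotient (unitarySetoid 𝓔)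

/-- The unitary equivalence class of a non-degenerate completely contractive bimodule map. -/
def NonDegClass.mk {𝓔 : CStarBimodule K₁ K₂} (r : NonDegMap 𝓔) : NonDegClass 𝓔 :=
  Quotient.mk (unitarySetoid 𝓔) r

end Bimodule

section Equivalence

variable {H₁ H₂ K₁ K₂ : Type u}
  [NormedAddCommGroup H₁] [InnerProductSpace ℂ H₁] [CompleteSpace H₁]
  [NormedAddCommGroup H₂] [InnerProductSpace ℂ H₂] [CompleteSpace H₂]
  [NormedAddCommGroup K₁] [InnerProductSpace ℂ K₁] [CompleteSpace K₁]
  [NormedAddCommGroup K₂] [InnerProductSpace ℂ K₂] [CompleteSpace K₂]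

/-- `X ⊆ B(K₁, K₂)` and `Y ⊆ B(H₁, H₂)` are strongly TRO equivalent by the TROs `M₁ ⊆ B(H₁, K₁)`
and `M₂ ⊆ B(H₂, K₂)`: `X = [M₂ Y M₁*]⁻` and `Y = [M₂* X M₁]⁻`. -/
structure StronglyTROEquivalentBy (X : Submodule ℂ (K₁ →L[ℂ] K₂)) (Y : Submodule ℂ (H₁ →L[ℂ] H₂))
    (M₁ : Submodule ℂ (H₁ →L[ℂ] K₁)) (M₂ : Submodule ℂ (H₂ →L[ℂ] K₂)) : Prop where
  tro₁ : IsTRO M₁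
  tro₂ : IsTRO M₂
  eq_left : X = ncl {T | ∃ m₂ ∈ M₂, ∃ y ∈ Y, ∃ m₁ ∈ M₁, T = m₂ ∘L y ∘L m₁†}
  eq_right : Y = ncl {T | ∃ m₂ ∈ M₂, ∃ x ∈ X, ∃ m₁ ∈ M₁, T = m₂† ∘L x ∘L m₁}

variable {X : Submodule ℂ (K₁ →L[ℂ] K₂)} {Y : Submodule ℂ (H₁ →L[ℂ] H₂)}
  {M₁ : Submodule ℂ (H₁ →L[ℂ] K₁)} {M₂ : Submodule ℂ (H₂ →L[ℂ] K₂)}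

theorem StronglyTROEquivalentBy.mem_right (h : StronglyTROEquivalentBy X Y M₁ M₂)
    {n : H₂ →L[ℂ] K₂} {x : K₁ →L[ℂ] K₂} {m : H₁ →L[ℂ] K₁}
    (hn : n ∈ M₂) (hx : x ∈ X) (hm : m ∈ M₁) : n† ∘L x ∘L m ∈ Y := by
  rw [h.eq_right]
  exact subset_ncl ⟨n, hn, x, hx, m, hm, rfl⟩

/-- The C*-bimodule `_A X_B` with `A = [M₂ M₂*]⁻` and `B = [M₁ M₁*]⁻`. -/
noncomputable def StronglyTROEquivalentBy.bimoduleX (h : StronglyTROEquivalentBy X Y M₁ M₂) :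
    CStarBimodule K₁ K₂ where
  A := leftAlg M₂ h.tro₂
  X := X
  B := leftAlg M₁ h.tro₁
  isClosed_A := isClosed_ncl (leftProducts M₂)
  isClosed_X := by rw [h.eq_left]; exact isClosed_ncl _
  isClosed_B := isClosed_ncl (leftProducts M₁)
  left_mem a ha x hx := by
    have ha' : a ∈ ncl (leftProducts M₂) := ha
    rw [h.eq_left] at hx ⊢
    refine comp_mem_of_ncl (isClosed_ncl _) ?_ ha' hx
    rintro _ ⟨m, hm, n, hn, rfl⟩ _ ⟨p, hp, y, hy, q, hq, rfl⟩
    exact subset_ncl ⟨m ∘L n† ∘L p, h.tro₂.ternary m hm n hn p hp, y, hy, q, hq, rfl⟩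
  right_mem x hx b hb := by
    have hb' : b ∈ ncl (leftProducts M₁) := hb
    rw [h.eq_left] at hx ⊢
    refine comp_mem_of_ncl (isClosed_ncl _) ?_ hx hb'
    rintro _ ⟨p, hp, y, hy, q, hq, rfl⟩ _ ⟨m, hm, n, hn, rfl⟩
    refine subset_ncl ⟨p, hp, y, hy, n ∘L m† ∘L q, h.tro₁.ternary n hn m hm q hq, ?_⟩
    simp [ContinuousLinearMap.adjoint_comp, ContinuousLinearMap.comp_assoc]

/-- The C*-bimodule `_C Y_D` with `C = [M₂* M₂]⁻` and `D = [M₁* M₁]⁻`. -/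
noncomputable def StronglyTROEquivalentBy.bimoduleY (h : StronglyTROEquivalentBy X Y M₁ M₂) :
    CStarBimodule H₁ H₂ where
  A := rightAlg M₂ h.tro₂
  X := Y
  B := rightAlg M₁ h.tro₁
  isClosed_A := isClosed_ncl (rightProducts M₂)
  isClosed_X := by rw [h.eq_right]; exact isClosed_ncl _
  isClosed_B := isClosed_ncl (rightProducts M₁)
  left_mem a ha x hx := by
    have ha' : a ∈ ncl (rightProducts M₂) := ha
    rw [h.eq_right] at hx ⊢
    refine comp_mem_of_ncl (isClosed_ncl _) ?_ ha' hx
    rintro _ ⟨m, hm, n, hn, rfl⟩ _ ⟨p, hp, y, hy, q, hq, rfl⟩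
    refine subset_ncl ⟨p ∘L n† ∘L m, h.tro₂.ternary p hp n hn m hm, y, hy, q, hq, ?_⟩
    simp [ContinuousLinearMap.adjoint_comp, ContinuousLinearMap.comp_assoc]
  right_mem x hx b hb := by
    have hb' : b ∈ ncl (rightProducts M₁) := hb
    rw [h.eq_right] at hx ⊢
    refine comp_mem_of_ncl (isClosed_ncl _) ?_ hx hb'
    rintro _ ⟨p, hp, y, hy, q, hq, rfl⟩ _ ⟨m, hm, n, hn, rfl⟩
    exact subset_ncl ⟨p, hp, y, hy, q ∘L m† ∘L n, h.tro₁.ternary q hq m hm n hn, rfl⟩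

/-- The correspondence between bimodule maps `r = (π, φ, σ)` of `_A X_B` and
`r' = (ρ, ψ, τ)` of `_C Y_D` implemented by the TROs: there are linear maps
`s : M₁ → B(L₁', L₁)` and `t : M₂ → B(L₂', L₂)` with
`s(m) s(n)* = σ(m n*)`, `s(m)* s(n) = τ(m* n)`, `t(m) t(n)* = π(m n*)`, `t(m)* t(n) = ρ(m* n)` and
`ψ(n* x m) = t(n)* φ(x) s(m)`. For non-degenerate `r` and `r'` this says that, up to
unitary equivalence, `L₁' = M₁* ⊗_σ L₁` and `L₂' = M₂* ⊗_π L₂`, with the canonical induced maps. -/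
def StronglyTROEquivalentBy.Corresponds (h : StronglyTROEquivalentBy X Y M₁ M₂)
    (r : BimoduleMap h.bimoduleX) (r' : BimoduleMap h.bimoduleY) : Prop :=
  ∃ (s : M₁ →ₗ[ℂ] (r'.L₁ →L[ℂ] r.L₁)) (t : M₂ →ₗ[ℂ] (r'.L₂ →L[ℂ] r.L₂)),
    (∀ m n : M₁, s m ∘L (s n)† = r.σ ⟨m ∘L (n : H₁ →L[ℂ] K₁)†, mem_leftAlg h.tro₁ m.2 n.2⟩) ∧
    (∀ m n : M₁, (s m)† ∘L s n = r'.σ ⟨(m : H₁ →L[ℂ] K₁)† ∘L n, mem_rightAlg h.tro₁ m.2 n.2⟩) ∧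
    (∀ m n : M₂, t m ∘L (t n)† = r.π ⟨m ∘L (n : H₂ →L[ℂ] K₂)†, mem_leftAlg h.tro₂ m.2 n.2⟩) ∧
    (∀ m n : M₂, (t m)† ∘L t n = r'.π ⟨(m : H₂ →L[ℂ] K₂)† ∘L n, mem_rightAlg h.tro₂ m.2 n.2⟩) ∧
    (∀ (n : M₂) (x : X) (m : M₁),
      r'.φ ⟨(n : H₂ →L[ℂ] K₂)† ∘L x ∘L m, h.mem_right n.2 x.2 m.2⟩ = (t n)† ∘L r.φ x ∘L s m)

end Equivalence

end StrongTRO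

/-! The correspondence is Rieffel induction along the two TROs. A representation `σ` of `[M M*]` on
`L` gives the kernel `(m, n) ↦ σ (m n*)`, and `L'` is the Hilbert space generated by vectors `(s m)*
ξ` with `s m (s n)* = σ (m n*)`. The kernel is positive (`posSemidef_kernel`) because `σ (m n*)` is
a limit of Gram sums `∑ σ (m p*) σ (p n*)`, where `∑ p* p` is an approximate unit of `[M* M]` formed
from finitely many `p ∈ M` (`approxUnit`).

An operator `T` between induced spaces is determined by its compressions `t n T (s m)*`. Hence `τ d`
and `ψ y` are defined by requiring their compressions to be `σ (m d n*)` and `φ (n y m*)`. These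
equations have explicit solutions when `d = p* q` or `y = n* x m`, and
`exists_linearMap_of_equations` extends them to closed spans once solutions are known to be bounded
by the data.

The bounds are the analytic core. For `τ`, the element `(‖d‖² - d* d)^(1/2)` multiplies `M` into
itself and gives a Pythagorean identity (`norm_le_of_compression`). For `ψ`, a matrix `T` is the
strong limit of `E₂ T E₁`, where `E₁` and `E₂` are sums `∑ (s p)* s p` and `∑ (t q)* t q`. The norm
of `E₂ T E₁` is controlled by the larger matrix `φ (q y p*)`, hence by `y`, since `φ` is completely
contractive (`matBound_of_compression`). Read backwards, the argument transports complete isometry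
(`matBound_of_isometric`).

Uniqueness holds because non-degeneracy forces any partner to live on the induced spaces, where the
Gram operators determine everything up to a unitary. Finally the relation `Linkable` is symmetric
under `M ↦ M*` (`linkable_symm_iff`), so each statement about passing from `X` to `Y` also serves in
the opposite direction. -/

namespace StrongTRO

open Filter Topology

/-! ### Operators with jointly dense ranges -/

section Density

variable {E F G : Type*}
  [NormedAddCommGroup E] [InnerProductSpace ℂ E]
  [NormedAddCommGroup F] [InnerProductSpace ℂ F]
  [NormedAddCommGroup G] [InnerProductSpace ℂ G]

/-- The ranges of the operators `u i` span a dense subspace. -/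
def DenseRanges {ι : Type*} (u : ι → E →L[ℂ] F) : Prop :=
  ncl {η : F | ∃ i ξ, η = u i ξ} = ⊤

variable {ι : Type*} {u : ι → E →L[ℂ] F}

/-- A closed property of vectors may be checked on finite sums of range vectors. -/
theorem DenseRanges.induction (hu : DenseRanges u) {P : F → Prop} (hP : IsClosed {v | P v})
    (h : ∀ (n : ℕ) (a : Fin n → ι) (ξ : Fin n → E), P (∑ i, u (a i) (ξ i))) (v : F) : P v := by
  have hv : v ∈ ncl {η : F | ∃ i ξ, η = u i ξ} := by
    rw [show ncl _ = ⊤ from hu]; trivial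
  have hv' : v ∈ closure (Submodule.span ℂ {η : F | ∃ i ξ, η = u i ξ} : Set F) := hv
  refine closure_minimal (t := {v | P v}) ?_ hP hv'
  intro w hw
  obtain ⟨n, c, g, rfl⟩ := Submodule.mem_span_set'.1 hw
  choose a ξ hg using fun i => (g i).2
  simpa [hg] using h n a fun i => c i • ξ i

theorem DenseRanges.ext (hu : DenseRanges u) {S T : F →L[ℂ] G}
    (h : ∀ i, S ∘L u i = T ∘L u i) : S = T := by
  ext v
  refine hu.induction (P := fun v => S v = T v) (isClosed_eq S.continuous T.continuous) ?_ v
  intro n a ξ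
  simp only [map_sum]
  exact Finset.sum_congr rfl fun i _ => DFunLike.congr_fun (h (a i)) (ξ i)

theorem DenseRanges.of_forall_mem {V : Submodule ℂ F} (hu : DenseRanges u)
    (hV : IsClosed (V : Set F)) (h : ∀ i ξ, u i ξ ∈ V) : V = ⊤ :=
  top_le_iff.1 <| (show ncl _ = ⊤ from hu) ▸ ncl_le hV (by rintro _ ⟨i, ξ, rfl⟩; exact h i ξ)

theorem DenseRanges.ext_left [CompleteSpace E] [CompleteSpace F] [CompleteSpace G]
    (hu : DenseRanges u) {S T : G →L[ℂ] F}
    (h : ∀ i, (u i)† ∘L S = (u i)† ∘L T) : S = T := by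
  apply (ContinuousLinearMap.adjoint (𝕜 := ℂ) (E := G) (F := F)).injective
  refine hu.ext fun i => ?_
  simpa [ContinuousLinearMap.adjoint_comp] using
    congrArg (ContinuousLinearMap.adjoint (𝕜 := ℂ)) (h i)

theorem DenseRanges.denseRange_lsum (hu : DenseRanges u) :
    DenseRange (Finsupp.lsum ℂ fun i => (u i : E →ₗ[ℂ] F)) := by
  classical
  intro v
  refine hu.induction (P := fun v => v ∈ closure (Set.range _)) isClosed_closure ?_ v
  intro n a ξ
  exact subset_closure ⟨∑ i, Finsupp.single (a i) (ξ i), by simp⟩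

/-- Two families of operators with dense ranges and the same Gram operators are
unitarily equivalent. -/
theorem DenseRanges.exists_unitary [CompleteSpace E] [CompleteSpace F] [CompleteSpace G]
    {w : ι → E →L[ℂ] G} (hu : DenseRanges u) (hw : DenseRanges w)
    (h : ∀ i j, (u i)† ∘L u j = (w i)† ∘L w j) :
    ∃ W : F ≃ₗᵢ[ℂ] G, ∀ i ξ, W (u i ξ) = w i ξ := by
  classical
  -- Both families become maps out of finitely supported vectors. Equal Gram operators give equal
  -- norms, so matching the two images extends to a unitary.
  let e₁ : (ι →₀ E) →ₗ[ℂ] F := Finsupp.lsum ℂ fun i => (u i : E →ₗ[ℂ] F)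
  let e₂ : (ι →₀ E) →ₗ[ℂ] G := Finsupp.lsum ℂ fun i => (w i : E →ₗ[ℂ] G)
  have hn : ∀ x, ‖e₂ ((LinearEquiv.refl ℂ (ι →₀ E)) x)‖ = ‖e₁ x‖ := by
    intro x
    have : (inner ℂ (e₂ x) (e₂ x) : ℂ) = inner ℂ (e₁ x) (e₁ x) := by
      simp only [e₁, e₂, Finsupp.coe_lsum, Finsupp.sum, sum_inner, inner_sum]
      refine Finset.sum_congr rfl fun i _ => Finset.sum_congr rfl fun j _ => ?_
      have := congrArg (fun T => inner ℂ (x j) (T (x i)) : (E →L[ℂ] E) → ℂ) (h j i)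
      simpa [ContinuousLinearMap.adjoint_inner_right] using this.symm
    have h2 : ‖e₂ x‖ ^ 2 = ‖e₁ x‖ ^ 2 := by
      have h3 := congrArg Complex.re this
      simpa [inner_self_eq_norm_sq_to_K, ← Complex.ofReal_pow] using h3
    exact (pow_left_inj₀ (norm_nonneg _) (norm_nonneg _) two_ne_zero).1 h2
  refine ⟨(LinearEquiv.refl ℂ (ι →₀ E)).extendOfIsometry e₁ e₂ hu.denseRange_lsum hw.denseRange_lsum hn, fun i ξ => ?_⟩
  have := LinearEquiv.extendOfIsometry_eq (LinearEquiv.refl ℂ (ι →₀ E)) e₁ e₂ hu.denseRange_lsum hw.denseRange_lsum hn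
    (Finsupp.single i ξ)
  simpa [e₁, e₂] using this

/-- A family of contractions converging to the identity on a set converges to the identity on its
closed linear span. -/
theorem tendsto_of_mem_ncl {V Λ : Type*} [NormedAddCommGroup V] [NormedSpace ℂ V] {l : Filter Λ}
    (Φ : Λ → V →ₗ[ℂ] V) (hΦ : ∀ k v, ‖Φ k v‖ ≤ ‖v‖) {S : Set V}
    (hS : ∀ v ∈ S, Tendsto (fun k => Φ k v) l (𝓝 v)) {v : V} (hv : v ∈ ncl S) :
    Tendsto (fun k => Φ k v) l (𝓝 v) := by
  let U : Submodule ℂ V :=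
    { carrier := {v | Tendsto (fun k => Φ k v) l (𝓝 v)}
      add_mem' := fun {a b} ha hb => by
        simpa only [Set.mem_ofPred_eq, map_add] using Tendsto.add ha hb
      zero_mem' := by simpa using tendsto_const_nhds
      smul_mem' := fun c a ha => by
        simpa only [Set.mem_ofPred_eq, map_smul] using Tendsto.const_smul ha c }
  refine ncl_le (U := U) ?_ hS hv
  -- A three-epsilon argument: contractivity transfers the closeness of `x n` to `v` uniformly in
  -- `k`.
  rw [← isSeqClosed_iff_isClosed]
  intro x v hx hv
  change Tendsto (fun k => Φ k v) l (𝓝 v)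
  rw [Metric.tendsto_nhds]
  intro ε hε
  obtain ⟨n, hn⟩ := ((Metric.tendsto_nhds.1 hv) (ε / 3) (by positivity)).exists
  have hxn : Tendsto (fun k => Φ k (x n)) l (𝓝 (x n)) := hx n
  filter_upwards [(Metric.tendsto_nhds.1 hxn) (ε / 3) (by positivity)] with k hk
  have h1 : dist (Φ k v) (Φ k (x n)) ≤ dist (x n) v := by
    rw [dist_comm (x n), dist_eq_norm, dist_eq_norm, ← map_sub]
    exact hΦ k _
  calc dist (Φ k v) v ≤ dist (Φ k v) (Φ k (x n)) + dist (Φ k (x n)) (x n) + dist (x n) v :=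
        dist_triangle4 _ _ _ _
    _ < ε := by linarith

end Density

/-! ### Linear maps on a closed span, defined by equations -/

section Lift

variable {V G G' : Type*} [NormedAddCommGroup V] [NormedSpace ℂ V]
  [NormedAddCommGroup G] [NormedSpace ℂ G]
  [NormedAddCommGroup G'] [NormedSpace ℂ G']

/-- Since `U` is closed in `V`, so is the image of `W`; it contains `S`, hence the closed span of
`S`. -/
theorem eq_top_of_forall_mem {U : Submodule ℂ V} {S : Set V} (hU : U = ncl S) {W : Submodule ℂ U}
    (hW : IsClosed (W : Set U)) (h : ∀ d : U, (d : V) ∈ S → d ∈ W) : W = ⊤ := by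
  have hUc : IsClosed (U : Set V) := hU ▸ isClosed_ncl S
  have hV' : IsClosed (W.map U.subtype : Set V) := by
    rw [Submodule.map_coe]
    exact hUc.isClosedEmbedding_subtypeVal.isClosedMap _ hW
  have : U ≤ W.map U.subtype := by
    conv_lhs => rw [hU]
    exact ncl_le hV' fun d hd => ⟨⟨d, hU ▸ subset_ncl hd⟩, h _ hd, rfl⟩
  refine top_le_iff.1 fun d _ => ?_
  obtain ⟨d', hd', h2⟩ := this d.2
  rwa [← show d' = d from Subtype.ext h2]

theorem ext_of_eq_ncl {U : Submodule ℂ V} {S : Set V} (hU : U = ncl S) {f g : U →L[ℂ] G}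
    (h : ∀ d : U, (d : V) ∈ S → f d = g d) : f = g := by
  have h1 : LinearMap.ker ((f - g : U →L[ℂ] G) : U →ₗ[ℂ] G) = ⊤ :=
    eq_top_of_forall_mem hU (ContinuousLinearMap.isClosed_ker (f - g)) fun d hd => by
      simp [h d hd]
  ext1 d
  have h2 : d ∈ LinearMap.ker ((f - g : U →L[ℂ] G) : U →ₗ[ℂ] G) := h1 ▸ Submodule.mem_top
  simpa [sub_eq_zero] using h2

/-- A contractive linear map determined by a system of linear equations exists as soon as the
system can be solved on a set of elements with dense span. -/
theorem exists_linearMap_of_equations [CompleteSpace V] [CompleteSpace G] {J : Type*} {U : Submodule ℂ V} {S : Set V}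
    (hU : U = ncl S) (Θ : J → G →L[ℂ] G') (f : J → U →L[ℂ] G')
    (hb : ∀ (d : U) (T : G), (∀ j, Θ j T = f j d) → ‖T‖ ≤ ‖d‖)
    (hS : ∀ d : U, (d : V) ∈ S → ∃ T, ∀ j, Θ j T = f j d) :
    ∃ F : U →ₗ[ℂ] G, ∀ j d, Θ j (F d) = f j d := by
  have hUc : IsClosed (U : Set V) := hU ▸ isClosed_ncl S
  have : CompleteSpace U := hUc.completeSpace_coe
  -- The graph of the map sought: all pairs `(d, T)` that satisfy every equation.
  let R : Submodule ℂ (U × G) := ⨅ j, LinearMap.ker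
    (((f j).comp (ContinuousLinearMap.fst ℂ U G) - (Θ j).comp (ContinuousLinearMap.snd ℂ U G) :
      U × G →L[ℂ] G') : U × G →ₗ[ℂ] G')
  have hR : ∀ p, p ∈ R ↔ ∀ j, Θ j p.2 = f j p.1 := by
    intro p
    simp only [R, Submodule.mem_iInf, LinearMap.mem_ker, ContinuousLinearMap.coe_coe]
    simp [sub_eq_zero, eq_comm (a := (Θ _) p.2)]
  have hRc : IsClosed (R : Set (U × G)) := by
    simp only [R, Submodule.coe_iInf]
    exact isClosed_iInter fun j => ContinuousLinearMap.isClosed_ker _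
  have : CompleteSpace R := hRc.completeSpace_coe
  -- By `hb` the max norm of `(d, T)` on the graph is `‖d‖`, so the projection to `U` is isometric.
  -- Its range is therefore closed, and by `hS` it contains every element of `U` lying in `S`.
  let g : R →ₗᵢ[ℂ] U :=
    { (LinearMap.fst ℂ U G).comp R.subtype with
      norm_map' := fun p => by
        have := hb p.1.1 p.1.2 ((hR _).1 p.2)
        exact (max_eq_left this).symm }
  have hg : IsClosed (Set.range g) := g.isometry.isClosedEmbedding.isClosed_range
  have hgs : Function.Surjective g := by
    have := eq_top_of_forall_mem hU (W := LinearMap.range g.toLinearMap) hg fun d hd => by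
      obtain ⟨T, hT⟩ := hS d hd
      exact ⟨⟨(d, T), (hR _).2 hT⟩, rfl⟩
    exact LinearMap.range_eq_top.1 this
  let ge : R ≃ₗᵢ[ℂ] U := LinearIsometryEquiv.ofSurjective g hgs
  refine ⟨(LinearMap.snd ℂ U G).comp (R.subtype.comp ge.symm.toLinearEquiv.toLinearMap),
    fun j d => ?_⟩
  have h1 := (hR _).1 (ge.symm d).2 j
  have h2 : (ge.symm d).1.1 = d := ge.apply_symm_apply d
  rw [h2] at h1
  exact h1

end Lift

/-! ### Functional calculus acting on a TRO -/

section Multipliers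

variable {H K : Type*}
  [NormedAddCommGroup H] [InnerProductSpace ℂ H] [CompleteSpace H]
  [NormedAddCommGroup K] [InnerProductSpace ℂ K] [CompleteSpace K]
  {M : Submodule ℂ (H →L[ℂ] K)}

theorem IsTRO.comp_right_mem (hM : IsTRO M) {m : H →L[ℂ] K} (hm : m ∈ M) {d : H →L[ℂ] H}
    (hd : d ∈ ncl (rightProducts M)) : m ∘L d ∈ M := by
  refine comp_mem_of_ncl (S := M) (T := rightProducts M) hM.isClosed ?_ (subset_ncl hm) hd
  rintro p hp _ ⟨m, hm, n, hn, rfl⟩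
  exact hM.ternary p hp m hm n hn

theorem adjoint_mem_ncl_rightProducts {d : H →L[ℂ] H} (hd : d ∈ ncl (rightProducts M)) :
    d† ∈ ncl (rightProducts M) := by
  refine star_mem_ncl ?_ hd
  rintro _ ⟨m, hm, n, hn, rfl⟩
  exact ⟨n, hn, m, hm, by
    simp [ContinuousLinearMap.star_eq_adjoint, ContinuousLinearMap.adjoint_comp]⟩

variable (M) in
/-- The operators `c` such that `M c ⊆ M` and `M c* ⊆ M`. -/
noncomputable def rightMultipliers : StarSubalgebra ℂ (H →L[ℂ] H) where
  carrier := {c | ∀ m ∈ M, m ∘L c ∈ M ∧ m ∘L c† ∈ M}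
  mul_mem' {a b} ha hb m hm := by
    refine ⟨(hb _ (ha m hm).1).1, ?_⟩
    rw [ContinuousLinearMap.mul_def, ContinuousLinearMap.adjoint_comp]
    exact (ha _ (hb m hm).2).2
  one_mem' m hm := by
    simpa [ContinuousLinearMap.one_def, ContinuousLinearMap.adjoint_id] using hm
  add_mem' {a b} ha hb m hm := by
    simpa only [map_add, ContinuousLinearMap.comp_add] using
      ⟨M.add_mem (ha m hm).1 (hb m hm).1, M.add_mem (ha m hm).2 (hb m hm).2⟩
  zero_mem' m hm := by simp
  algebraMap_mem' c m hm := by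
    simp only [Algebra.algebraMap_eq_smul_one, map_smulₛₗ, ContinuousLinearMap.one_def,
      ContinuousLinearMap.adjoint_id, ContinuousLinearMap.comp_smul, ContinuousLinearMap.comp_id]
    exact ⟨M.smul_mem _ hm, M.smul_mem _ hm⟩
  star_mem' {a} ha m hm := by
    simpa [ContinuousLinearMap.star_eq_adjoint] using (ha m hm).symm

theorem IsTRO.isClosed_rightMultipliers (hM : IsTRO M) :
    IsClosed (rightMultipliers M : Set (H →L[ℂ] H)) := by
  have : (rightMultipliers M : Set (H →L[ℂ] H)) =
      ⋂ m ∈ M, {c | m ∘L c ∈ M} ∩ {c | m ∘L c† ∈ M} := by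
    ext c; simp [rightMultipliers]
  rw [this]
  refine isClosed_biInter fun m _ => .inter ?_ ?_
  · exact hM.isClosed.preimage (ContinuousLinearMap.compL ℂ H H K m).continuous
  · exact hM.isClosed.preimage ((ContinuousLinearMap.compL ℂ H H K m).continuous.comp
      (ContinuousLinearMap.adjoint (𝕜 := ℂ)).continuous)

theorem IsTRO.mem_rightMultipliers (hM : IsTRO M) {d : H →L[ℂ] H}
    (hd : d ∈ ncl (rightProducts M)) : d ∈ rightMultipliers M := fun _ hm =>
  ⟨hM.comp_right_mem hm hd, hM.comp_right_mem hm (adjoint_mem_ncl_rightProducts hd)⟩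

/-- When `f 0 ≠ 0` the operator `f(d)` may leave `[M* M]`. It remains in the closed unital algebra
of right multipliers of `M`, which is all that is needed. -/
theorem IsTRO.comp_cfc_mem (hM : IsTRO M) {m : H →L[ℂ] K} (hm : m ∈ M) {d : H →L[ℂ] H}
    (hd : d ∈ ncl (rightProducts M)) (f : ℝ → ℝ) : m ∘L cfc f d ∈ M := by
  have := hM.isClosed_rightMultipliers
  exact (cfc_mem (s := rightMultipliers M) f (hM.mem_rightMultipliers hd) m hm).1

end Multipliers

/-! ### Approximate units of `[M* M]` built from finite families in `M` -/

section ApproximateUnit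

variable {H K : Type*}
  [NormedAddCommGroup H] [InnerProductSpace ℂ H] [CompleteSpace H]
  [NormedAddCommGroup K] [InnerProductSpace ℂ K] [CompleteSpace K]
  {M : Submodule ℂ (H →L[ℂ] K)}

theorem isPositive_sum_adjoint_comp (s : Finset M) :
    0 ≤ ∑ m ∈ s, (m : H →L[ℂ] K)† ∘L (m : H →L[ℂ] K) := by
  refine Finset.sum_nonneg fun m _ => ?_
  rw [ContinuousLinearMap.nonneg_iff_isPositive]
  exact ContinuousLinearMap.isPositive_adjoint_comp_self _

/-- The functions `t ↦ (δ + t)^(-1/2)`, with `δ = 1 / (k + 1)`. -/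
noncomputable def regInvSqrt (k : ℕ) (t : ℝ) : ℝ := (√(1 / (k + 1) + t))⁻¹

/-- The elements `m (δ + ∑ p* p)^(-1/2)` for `m` in the finite set `s ⊆ M`, where `p` runs through
`s` and `δ = 1 / (k + 1)`. -/
noncomputable def unitRow (l : Finset M × ℕ) (m : l.1) : H →L[ℂ] K :=
  (m : H →L[ℂ] K) ∘L cfc (regInvSqrt l.2)
    (∑ m ∈ l.1, (m : H →L[ℂ] K)† ∘L (m : H →L[ℂ] K))

/-- An approximate unit `∑ p* p` of `[M* M]`. -/
noncomputable def approxUnit (l : Finset M × ℕ) : H →L[ℂ] H :=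
  ∑ k, (unitRow l k)† ∘L unitRow l k

theorem IsTRO.unitRow_mem (hM : IsTRO M) (l : Finset M × ℕ) (m : l.1) : unitRow l m ∈ M := by
  refine hM.comp_cfc_mem m.1.2 (Submodule.sum_mem _ fun p _ => ?_) _
  exact subset_ncl ⟨p, p.2, p, p.2, rfl⟩

theorem IsTRO.approxUnit_mem (hM : IsTRO M) (l : Finset M × ℕ) :
    approxUnit l ∈ ncl (rightProducts M) :=
  Submodule.sum_mem _ fun _ _ => subset_ncl ⟨_, hM.unitRow_mem _ _, _, hM.unitRow_mem _ _, rfl⟩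

theorem continuousOn_regInvSqrt (k : ℕ) : ContinuousOn (regInvSqrt k) (Set.Ici 0) := by
  unfold regInvSqrt
  refine ContinuousOn.inv₀ (by fun_prop) fun t ht => ?_
  have : 0 < 1 / ((k : ℝ) + 1) + t := add_pos_of_pos_of_nonneg (by positivity) ht
  positivity

/-- With `e = ∑ m* m` and `f` the regularised inverse square root, the sum collapses to `f(e) e
f(e)`, which is `e (δ + e)⁻¹`. -/
theorem approxUnit_eq_cfc (l : Finset M × ℕ) :
    approxUnit l = cfc (fun t => regInvSqrt l.2 t * (t * regInvSqrt l.2 t))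
      (∑ m ∈ l.1, (m : H →L[ℂ] K)† ∘L (m : H →L[ℂ] K)) := by
  set e := ∑ m ∈ l.1, (m : H →L[ℂ] K)† ∘L (m : H →L[ℂ] K) with he
  have he0 : 0 ≤ e := isPositive_sum_adjoint_comp l.1
  have hsp : ∀ t ∈ spectrum ℝ e, 0 ≤ t := spectrum_nonneg_of_nonneg he0
  have hc : ContinuousOn (regInvSqrt l.2) (spectrum ℝ e) :=
    (continuousOn_regInvSqrt l.2).mono hsp
  have hg : ContinuousOn (fun t => t * regInvSqrt l.2 t) (spectrum ℝ e) := continuousOn_id.mul hc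
  have hsa : IsSelfAdjoint (cfc (regInvSqrt l.2) e) := cfc_predicate _ _
  rw [cfc_mul _ _ e hc hg,
    cfc_mul (fun t => t) _ e continuousOn_id hc,
    cfc_id' ℝ e (.of_nonneg he0)]
  conv_rhs => enter [2]; rw [he]
  simp only [approxUnit, unitRow, ← he, ContinuousLinearMap.adjoint_comp,
    ContinuousLinearMap.isSelfAdjoint_iff'.1 hsa]
  rw [Finset.sum_mul, Finset.mul_sum]
  exact Finset.sum_coe_sort l.1 fun i : M =>
    cfc (regInvSqrt l.2) e * ((i : H →L[ℂ] K)† ∘L (i : H →L[ℂ] K) * cfc (regInvSqrt l.2) e)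

theorem norm_approxUnit_le (l : Finset M × ℕ) : ‖approxUnit l‖ ≤ 1 := by
  rw [approxUnit_eq_cfc]
  refine norm_cfc_le zero_le_one fun t ht => ?_
  have ht0 : 0 ≤ t := spectrum_nonneg_of_nonneg (isPositive_sum_adjoint_comp l.1) ht
  have hp : 0 < 1 / ((l.2 : ℝ) + 1) := by positivity
  have : regInvSqrt l.2 t * (t * regInvSqrt l.2 t) = t / (1 / (l.2 + 1) + t) := by
    rw [mul_left_comm, regInvSqrt, ← mul_inv, Real.mul_self_sqrt (by positivity)]
    rfl
  rw [this, Real.norm_of_nonneg (by positivity), div_le_one (by positivity)]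
  linarith

/-- A finite family `p` of operators with `‖∑ (p k)* p k‖ ≤ 1` is a column contraction. -/
theorem sum_norm_sq_le_of_norm_sum_le {ι : Type*} [Fintype ι] {p : ι → H →L[ℂ] K}
    (hp : ‖∑ k, (p k)† ∘L p k‖ ≤ 1) (u : H) : ∑ k, ‖p k u‖ ^ 2 ≤ ‖u‖ ^ 2 := by
  have h1 : ∑ k, ‖p k u‖ ^ 2 = RCLike.re (inner ℂ ((∑ k, (p k)† ∘L p k) u) u) := by
    simp [ContinuousLinearMap.adjoint_inner_left,
      inner_self_eq_norm_sq_to_K, ← Complex.ofReal_pow]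
  rw [h1]
  calc _ ≤ ‖inner ℂ ((∑ k, (p k)† ∘L p k) u) u‖ := RCLike.re_le_norm _
    _ ≤ ‖(∑ k, (p k)† ∘L p k) u‖ * ‖u‖ := norm_inner_le_norm _ _
    _ ≤ (1 * ‖u‖) * ‖u‖ := by gcongr; exact ContinuousLinearMap.le_of_opNorm_le _ hp u
    _ = _ := by ring

/-- For `m` in the finite set, `m* m ≤ e`. So the square of the norm is at most that of `(1 - u) e
(1 - u)`, with `u` the approximate unit, and `t (δ / (δ + t))² ≤ δ` for `t ≥ 0`. -/
theorem norm_comp_one_sub_approxUnit_le (l : Finset M × ℕ) {m : M} (hm : m ∈ l.1) :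
    ‖(m : H →L[ℂ] K) ∘L (1 - approxUnit l)‖ ≤ √(1 / (l.2 + 1)) := by
  set e := ∑ m ∈ l.1, (m : H →L[ℂ] K)† ∘L (m : H →L[ℂ] K) with he
  have he0 : 0 ≤ e := isPositive_sum_adjoint_comp l.1
  have hsp : ∀ t ∈ spectrum ℝ e, 0 ≤ t := spectrum_nonneg_of_nonneg he0
  have hc : ContinuousOn (regInvSqrt l.2) (spectrum ℝ e) :=
    (continuousOn_regInvSqrt l.2).mono hsp
  have hesa : IsSelfAdjoint e := .of_nonneg he0
  have hg : ContinuousOn (fun t => t * regInvSqrt l.2 t) (spectrum ℝ e) := continuousOn_id.mul hc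
  have hcg : ContinuousOn (fun t => regInvSqrt l.2 t * (t * regInvSqrt l.2 t)) (spectrum ℝ e) :=
    hc.mul hg
  let f : ℝ → ℝ := fun t => 1 - regInvSqrt l.2 t * (t * regInvSqrt l.2 t)
  have hf : ContinuousOn f (spectrum ℝ e) :=
    continuousOn_const.sub hcg
  have hf' : ContinuousOn (fun t => t * f t) (spectrum ℝ e) := continuousOn_id.mul hf
  have h1 : 1 - approxUnit l = cfc f e := by
    rw [approxUnit_eq_cfc, ← he, cfc_sub (fun _ => 1) _ e continuousOn_const hcg,
      cfc_const_one ℝ e]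
  have hsa : IsSelfAdjoint (cfc f e) := cfc_predicate _ _
  have h2 : ‖cfc f e * (e * cfc f e)‖ ≤ 1 / (l.2 + 1) := by
    conv_lhs => enter [1, 2, 1]; rw [← cfc_id' ℝ e]
    rw [← cfc_mul (fun t => t) _ e continuousOn_id hf, ← cfc_mul _ _ e hf hf']
    refine norm_cfc_le (by positivity) fun t ht => ?_
    have ht0 : 0 ≤ t := hsp t ht
    have hp : 0 < 1 / ((l.2 : ℝ) + 1) := by positivity
    set δ : ℝ := 1 / ((l.2 : ℝ) + 1) with hδ
    have : f t = δ / (δ + t) := by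
      simp only [f]
      rw [mul_left_comm, regInvSqrt, ← mul_inv, Real.mul_self_sqrt (by positivity), ← hδ]
      field_simp
      ring
    rw [this, Real.norm_of_nonneg (by positivity)]
    have h3 : δ / (δ + t) * (t * (δ / (δ + t))) = δ * (δ * t / (δ + t) ^ 2) := by
      field_simp
    rw [h3]
    refine mul_le_of_le_one_right hp.le ?_
    rw [div_le_one (by positivity)]
    nlinarith [mul_nonneg hp.le ht0, sq_nonneg δ, sq_nonneg t]
  rw [h1]
  refine ContinuousLinearMap.opNorm_le_bound _ (Real.sqrt_nonneg _) fun u => ?_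
  have h4 : ‖(m : H →L[ℂ] K) (cfc f e u)‖ ^ 2 ≤ 1 / (l.2 + 1) * ‖u‖ ^ 2 := by
    calc ‖(m : H →L[ℂ] K) (cfc f e u)‖ ^ 2
        ≤ ∑ p ∈ l.1, ‖(p : H →L[ℂ] K) (cfc f e u)‖ ^ 2 :=
          Finset.single_le_sum (f := fun p : M => ‖(p : H →L[ℂ] K) (cfc f e u)‖ ^ 2)
            (fun _ _ => by positivity) hm
      _ = RCLike.re (inner ℂ ((cfc f e * (e * cfc f e)) u) u) := by
          have : (inner ℂ ((cfc f e * (e * cfc f e)) u) u : ℂ) =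
              inner ℂ (e (cfc f e u)) (cfc f e u) := by
            rw [mul_apply_eq_comp, ← ContinuousLinearMap.adjoint_inner_right,
              ContinuousLinearMap.isSelfAdjoint_iff'.1 hsa]
            rfl
          rw [this]
          simp [he, ContinuousLinearMap.adjoint_inner_left,
            inner_self_eq_norm_sq_to_K, ← Complex.ofReal_pow]
      _ ≤ ‖inner ℂ ((cfc f e * (e * cfc f e)) u) u‖ := RCLike.re_le_norm _
      _ ≤ ‖(cfc f e * (e * cfc f e)) u‖ * ‖u‖ := norm_inner_le_norm _ _
      _ ≤ (1 / (l.2 + 1) * ‖u‖) * ‖u‖ := by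
          gcongr; exact ContinuousLinearMap.le_of_opNorm_le _ h2 u
      _ = _ := by ring
  calc _ = √(‖(m : H →L[ℂ] K) (cfc f e u)‖ ^ 2) := by
        rw [Real.sqrt_sq (norm_nonneg _)]; rfl
    _ ≤ √(1 / (l.2 + 1) * ‖u‖ ^ 2) := Real.sqrt_le_sqrt h4
    _ = _ := by rw [Real.sqrt_mul (by positivity), Real.sqrt_sq (norm_nonneg _)]

theorem tendsto_comp_approxUnit {m : H →L[ℂ] K} (hm : m ∈ M) :
    Tendsto (fun l : Finset M × ℕ => m ∘L approxUnit l) atTop (𝓝 m) := by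
  rw [tendsto_iff_norm_sub_tendsto_zero]
  have h0 : Tendsto (fun l : Finset M × ℕ => √(1 / ((l.2 : ℝ) + 1))) atTop (𝓝 0) := by
    have := (tendsto_one_div_add_atTop_nhds_zero_nat (𝕜 := ℝ)).sqrt
    rw [Real.sqrt_zero] at this
    rw [← prod_atTop_atTop_eq]
    exact this.comp tendsto_snd
  refine squeeze_zero' (.of_forall fun _ => norm_nonneg _) ?_ h0
  filter_upwards [eventually_ge_atTop (({⟨m, hm⟩} : Finset M), 0)] with l hl
  have : (⟨m, hm⟩ : M) ∈ l.1 := hl.1 (Finset.mem_singleton_self _)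
  refine le_trans (le_of_eq ?_) (norm_comp_one_sub_approxUnit_le l this)
  rw [norm_sub_rev]
  simp [ContinuousLinearMap.comp_sub, ContinuousLinearMap.one_def]

end ApproximateUnit

/-! ### Dual TROs, induced spaces and the basic norm estimate -/

section Pair

variable {H K L L' : Type*}
  [NormedAddCommGroup H] [InnerProductSpace ℂ H] [CompleteSpace H]
  [NormedAddCommGroup K] [InnerProductSpace ℂ K] [CompleteSpace K]
  [NormedAddCommGroup L] [InnerProductSpace ℂ L] [CompleteSpace L]
  [NormedAddCommGroup L'] [InnerProductSpace ℂ L'] [CompleteSpace L']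

/-- `M` is a TRO with `B = [M M*]` and `D = [M* M]`. -/
structure TROPair (M : Submodule ℂ (H →L[ℂ] K)) (B : NonUnitalStarSubalgebra ℂ (K →L[ℂ] K))
    (D : NonUnitalStarSubalgebra ℂ (H →L[ℂ] H)) : Prop where
  tro : IsTRO M
  mem_left : ∀ b, b ∈ B ↔ b ∈ ncl (leftProducts M)
  mem_right : ∀ d, d ∈ D ↔ d ∈ ncl (rightProducts M)

/-- The TRO `M*` of adjoints of elements of `M`. -/
noncomputable def adjointTRO (M : Submodule ℂ (H →L[ℂ] K)) : Submodule ℂ (K →L[ℂ] H) where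
  carrier := {T | T† ∈ M}
  add_mem' {S T} hS hT := by
    simpa only [Set.mem_ofPred_eq, map_add] using M.add_mem hS hT
  zero_mem' := by simp
  smul_mem' c T hT := by
    simpa only [Set.mem_ofPred_eq, map_smulₛₗ] using M.smul_mem _ hT

variable {M : Submodule ℂ (H →L[ℂ] K)} {B : NonUnitalStarSubalgebra ℂ (K →L[ℂ] K)}
  {D : NonUnitalStarSubalgebra ℂ (H →L[ℂ] H)}

theorem mem_adjointTRO {T : K →L[ℂ] H} : T ∈ adjointTRO M ↔ T† ∈ M := Iff.rfl

theorem adjoint_mem_adjointTRO {m : H →L[ℂ] K} : m† ∈ adjointTRO M ↔ m ∈ M := by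
  simp [mem_adjointTRO]

theorem leftProducts_adjointTRO : leftProducts (adjointTRO M) = rightProducts M := by
  ext T
  constructor
  · rintro ⟨m, hm, n, hn, rfl⟩
    exact ⟨m†, hm, n†, hn, by simp⟩
  · rintro ⟨m, hm, n, hn, rfl⟩
    exact ⟨m†, adjoint_mem_adjointTRO.2 hm, n†, adjoint_mem_adjointTRO.2 hn, by simp⟩

theorem rightProducts_adjointTRO : rightProducts (adjointTRO M) = leftProducts M := by
  ext T
  constructor
  · rintro ⟨m, hm, n, hn, rfl⟩
    exact ⟨m†, hm, n†, hn, by simp⟩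
  · rintro ⟨m, hm, n, hn, rfl⟩
    exact ⟨m†, adjoint_mem_adjointTRO.2 hm, n†, adjoint_mem_adjointTRO.2 hn, by simp⟩

theorem IsTRO.adjoint (hM : IsTRO M) : IsTRO (adjointTRO M) where
  isClosed := hM.isClosed.preimage (ContinuousLinearMap.adjoint (𝕜 := ℂ)).continuous
  ternary m hm n hn p hp := by
    have := hM.ternary _ hp _ hn _ hm
    simpa [mem_adjointTRO, ContinuousLinearMap.adjoint_comp, ContinuousLinearMap.comp_assoc]
      using this

namespace TROPair

variable (hP : TROPair M B D)
include hP

/-- Passing to `M*` exchanges the two algebras, so later results need proof on one side only. -/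
theorem symm : TROPair (adjointTRO M) D B where
  tro := hP.tro.adjoint
  mem_left d := by rw [leftProducts_adjointTRO]; exact hP.mem_right d
  mem_right b := by rw [rightProducts_adjointTRO]; exact hP.mem_left b

theorem isClosed_left : IsClosed (B : Set (K →L[ℂ] K)) := by
  have : (B : Set (K →L[ℂ] K)) = ncl (leftProducts M) := Set.ext hP.mem_left
  rw [this]; exact isClosed_ncl _

theorem isClosed_right : IsClosed (D : Set (H →L[ℂ] H)) := hP.symm.isClosed_left

theorem left_mem {m n : H →L[ℂ] K} (hm : m ∈ M) (hn : n ∈ M) : m ∘L n† ∈ B :=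
  (hP.mem_left _).2 (subset_ncl ⟨m, hm, n, hn, rfl⟩)

theorem right_mem {m n : H →L[ℂ] K} (hm : m ∈ M) (hn : n ∈ M) : m† ∘L n ∈ D :=
  (hP.mem_right _).2 (subset_ncl ⟨m, hm, n, hn, rfl⟩)

theorem comp_right_mem {m : H →L[ℂ] K} (hm : m ∈ M) {d : H →L[ℂ] H} (hd : d ∈ D) : m ∘L d ∈ M :=
  hP.tro.comp_right_mem hm ((hP.mem_right _).1 hd)

theorem sandwich_mem {m n : H →L[ℂ] K} (hm : m ∈ M) (hn : n ∈ M) {d : H →L[ℂ] H} (hd : d ∈ D) :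
    m ∘L d ∘L n† ∈ B :=
  hP.left_mem (hP.comp_right_mem hm hd) hn

theorem approxUnit_mem (l : Finset M × ℕ) : approxUnit l ∈ D :=
  (hP.mem_right _).2 (hP.tro.approxUnit_mem l)

end TROPair

/-- The map `u ↦ a u b` between spaces of operators. -/
noncomputable def sandwich {E F E' F' : Type*}
    [NormedAddCommGroup E] [InnerProductSpace ℂ E] [NormedAddCommGroup F] [InnerProductSpace ℂ F]
    [NormedAddCommGroup E'] [InnerProductSpace ℂ E']
    [NormedAddCommGroup F'] [InnerProductSpace ℂ F']
    (U : Submodule ℂ (E →L[ℂ] F)) (U' : Submodule ℂ (E' →L[ℂ] F')) (a : F →L[ℂ] F')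
    (b : E' →L[ℂ] E) (h : ∀ u ∈ U, a ∘L u ∘L b ∈ U') : U →L[ℂ] U' :=
  ((ContinuousLinearMap.compL ℂ E' F F' a ∘L (ContinuousLinearMap.compL ℂ E' E F).flip b) ∘L
    U.subtypeL).codRestrict U' fun u => h u u.2

/-- A `*`-homomorphism out of a C*-algebra is contractive; closedness is what makes `B` a
C*-algebra. -/
theorem norm_rep_le (hB : IsClosed (B : Set (K →L[ℂ] K))) (σ : B →⋆ₙₐ[ℂ] (L →L[ℂ] L)) (b : B) :
    ‖σ b‖ ≤ ‖(b : K →L[ℂ] K)‖ := by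
  have := hB
  exact NonUnitalStarAlgHom.norm_apply_le σ b

/-- A `*`-representation as a continuous linear map. -/
noncomputable def repCLM (hB : IsClosed (B : Set (K →L[ℂ] K))) (σ : B →⋆ₙₐ[ℂ] (L →L[ℂ] L)) :
    B.toSubmodule →L[ℂ] (L →L[ℂ] L) :=
  LinearMap.mkContinuous
    { toFun := fun b => σ ⟨b.1, b.2⟩
      map_add' := fun a b => map_add σ ⟨a.1, a.2⟩ ⟨b.1, b.2⟩
      map_smul' := fun c b => map_smul σ c ⟨b.1, b.2⟩ } 1
    fun b => by simpa using norm_rep_le hB σ ⟨b.1, b.2⟩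

/-- `L'` with the operators `s m : L' → L` is the space induced from the representation `σ` of
`B = [M M*]` along `M`: `s m (s n)* = σ (m n*)`, and the ranges of the `(s m)*` span `L'`. -/
structure IsInduced (σ : B →⋆ₙₐ[ℂ] (L →L[ℂ] L)) (s : M →ₗ[ℂ] (L' →L[ℂ] L)) : Prop where
  mul : ∀ (m n : M) (b : B), (b : K →L[ℂ] K) = m ∘L (n : H →L[ℂ] K)† → s m ∘L (s n)† = σ b
  dense : DenseRanges fun m => (s m)†

namespace IsInduced

variable {σ : B →⋆ₙₐ[ℂ] (L →L[ℂ] L)} {s : M →ₗ[ℂ] (L' →L[ℂ] L)}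

/-- The C*-identity turns contractivity of `σ` at `m m*` into contractivity of `s` at `m`. -/
theorem norm_le (hP : TROPair M B D) (hs : IsInduced σ s) (m : M) : ‖s m‖ ≤ ‖m‖ := by
  have h1 : ‖s m ∘L (s m)†‖ = ‖s m‖ * ‖s m‖ := by
    simpa using ContinuousLinearMap.norm_adjoint_comp_self ((s m)†)
  have h2 : ‖(m : H →L[ℂ] K) ∘L (m : H →L[ℂ] K)†‖ = ‖m‖ * ‖m‖ := by
    simpa using ContinuousLinearMap.norm_adjoint_comp_self ((m : H →L[ℂ] K)†)
  have h3 := norm_rep_le hP.isClosed_left σ ⟨_, hP.left_mem m.2 m.2⟩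
  rw [← hs.mul m m _ rfl, h1, h2] at h3
  exact (mul_self_le_mul_self_iff (norm_nonneg _) (norm_nonneg _)).2 h3

theorem continuous (hP : TROPair M B D) (hs : IsInduced σ s) : Continuous s :=
  (s.mkContinuous 1 fun m => by simpa using hs.norm_le hP m).continuous

/-- If `T` compresses to `σ (m d n*)`, then `T (s n)* = (s (n d*))*`. -/
theorem comp_adjoint (hP : TROPair M B D) (hs : IsInduced σ s) {d : H →L[ℂ] H} (hd : d ∈ D)
    {T : L' →L[ℂ] L'} (hT : ∀ (m n : M) (b : B),
      (b : K →L[ℂ] K) = m ∘L d ∘L (n : H →L[ℂ] K)† → s m ∘L T ∘L (s n)† = σ b)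
    (n n' : M) (hn' : (n' : H →L[ℂ] K) = n ∘L d†) : T ∘L (s n)† = (s n')† := by
  refine hs.dense.ext_left fun m => ?_
  rw [ContinuousLinearMap.adjoint_adjoint,
    hT m n ⟨_, hP.sandwich_mem m.2 n.2 hd⟩ rfl, hs.mul m n' ⟨_, hP.left_mem m.2 n'.2⟩ rfl]
  congr 2
  simp [hn', ContinuousLinearMap.adjoint_comp]

/-- Put `c = (‖d‖² - d* d)^(1/2)`. Then `(m d*)(n d*)* + (m c)(n c)* = ‖d‖² m n*`. For `v = ∑ (s
mᵢ)* ξᵢ` one has `T v = ∑ (s (mᵢ d*))* ξᵢ`, so `‖T v‖² + ‖∑ (s (mᵢ c))* ξᵢ‖² = ‖d‖² ‖v‖²`. Only the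
compressions of `T` enter, so the bound is available before `τ` is constructed. -/
theorem norm_le_of_compression (hP : TROPair M B D) (hs : IsInduced σ s) {d : H →L[ℂ] H}
    (hd : d ∈ D) {T : L' →L[ℂ] L'} (hT : ∀ (m n : M) (b : B),
      (b : K →L[ℂ] K) = m ∘L d ∘L (n : H →L[ℂ] K)† → s m ∘L T ∘L (s n)† = σ b) :
    ‖T‖ ≤ ‖d‖ := by
  have hd' : d† ∈ D := star_mem (s := D) hd
  have hdd : d† ∘L d ∈ D := mul_mem (s := D) hd' hd
  -- The spectrum of `d* d` lies below `‖d‖²`, so the value of `√` at negative numbers never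
  -- matters.
  let f : ℝ → ℝ := fun t => √(‖d‖ ^ 2 - t)
  let c : H →L[ℂ] H := cfc f (d† ∘L d)
  have hcM : ∀ m : M, (m : H →L[ℂ] K) ∘L c ∈ M := fun m =>
    hP.tro.comp_cfc_mem m.2 ((hP.mem_right _).1 hdd) _
  have hc0 : 0 ≤ d† ∘L d := by
    rw [ContinuousLinearMap.nonneg_iff_isPositive]
    exact ContinuousLinearMap.isPositive_adjoint_comp_self _
  have hcsa : c† = c := ContinuousLinearMap.isSelfAdjoint_iff'.1 (cfc_predicate _ _)
  have hcc : c * c = (‖d‖ ^ 2 : ℝ) • 1 - d† ∘L d := by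
    have hf : ContinuousOn f (spectrum ℝ (d† ∘L d)) := by fun_prop
    have hsa : IsSelfAdjoint (d† ∘L d) := .of_nonneg hc0
    rw [← cfc_mul f f _ hf hf]
    have : cfc (fun t => f t * f t) (d† ∘L d) = cfc (fun t => ‖d‖ ^ 2 - t) (d† ∘L d) := by
      refine cfc_congr fun t ht => ?_
      have h1 : ‖t‖ ≤ ‖d† ∘L d‖ := IsometricContinuousFunctionalCalculus.norm_spectrum_le (𝕜 := ℝ) _ ht hsa
      rw [ContinuousLinearMap.norm_adjoint_comp_self, ← pow_two] at h1
      exact Real.mul_self_sqrt (sub_nonneg.2 ((le_abs_self t).trans h1))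
    rw [this, cfc_sub (fun _ => ‖d‖ ^ 2) (fun t => t) _ continuousOn_const continuousOn_id,
      cfc_id' ℝ _ hsa, cfc_const _ _ hsa, Algebra.algebraMap_eq_smul_one]
  refine ContinuousLinearMap.opNorm_le_bound _ (norm_nonneg _) fun v => ?_
  refine hs.dense.induction (P := fun v => ‖T v‖ ≤ ‖d‖ * ‖v‖)
    (isClosed_le (by fun_prop) (by fun_prop)) (fun N a ξ => ?_) v
  let a' : Fin N → M := fun i => ⟨(a i : H →L[ℂ] K) ∘L d†, hP.comp_right_mem (a i).2 hd'⟩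
  let a'' : Fin N → M := fun i => ⟨(a i : H →L[ℂ] K) ∘L c, hcM (a i)⟩
  have hTv : T (∑ i, ((s (a i))†) (ξ i)) = ∑ i, ((s (a' i))†) (ξ i) := by
    rw [map_sum]
    exact Finset.sum_congr rfl fun i _ =>
      DFunLike.congr_fun (hs.comp_adjoint hP hd hT (a i) (a' i) rfl) (ξ i)
  have key : ∀ i j, s (a' i) ∘L (s (a' j))† + s (a'' i) ∘L (s (a'' j))† =
      (‖d‖ ^ 2 : ℂ) • (s (a i) ∘L (s (a j))†) := by
    intro i j
    rw [hs.mul _ _ ⟨_, hP.left_mem (a' i).2 (a' j).2⟩ rfl,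
      hs.mul _ _ ⟨_, hP.left_mem (a'' i).2 (a'' j).2⟩ rfl,
      hs.mul _ _ ⟨_, hP.left_mem (a i).2 (a j).2⟩ rfl, ← map_add, ← map_smul]
    congr 1
    apply Subtype.ext
    change (a' i : H →L[ℂ] K) ∘L (a' j : H →L[ℂ] K)† + (a'' i : H →L[ℂ] K) ∘L
      (a'' j : H →L[ℂ] K)† = (‖d‖ ^ 2 : ℂ) • ((a i : H →L[ℂ] K) ∘L (a j : H →L[ℂ] K)†)
    have h2 : (a'' i : H →L[ℂ] K) ∘L (a'' j : H →L[ℂ] K)† =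
        (a i : H →L[ℂ] K) ∘L (c * c) ∘L (a j : H →L[ℂ] K)† := by
      simp [a'', ContinuousLinearMap.adjoint_comp, hcsa, ContinuousLinearMap.mul_def,
        ContinuousLinearMap.comp_assoc]
    rw [h2, hcc, ← Complex.ofReal_pow, Complex.coe_smul]
    ext u
    simp [a', ContinuousLinearMap.adjoint_comp]
  have expand : ∀ (w : Fin N → M), (‖∑ i, ((s (w i))†) (ξ i)‖ : ℂ) ^ 2 =
      ∑ i, ∑ j, inner ℂ (ξ i) ((s (w i) ∘L (s (w j))†) (ξ j)) := by
    intro w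
    refine (inner_self_eq_norm_sq_to_K (𝕜 := ℂ) (∑ i, ((s (w i))†) (ξ i))).symm.trans ?_
    simp only [sum_inner, inner_sum, ContinuousLinearMap.adjoint_inner_left]
    exact Finset.sum_comm
  have total : ‖∑ i, ((s (a' i))†) (ξ i)‖ ^ 2 + ‖∑ i, ((s (a'' i))†) (ξ i)‖ ^ 2 =
      ‖d‖ ^ 2 * ‖∑ i, ((s (a i))†) (ξ i)‖ ^ 2 := by
    have : (‖∑ i, ((s (a' i))†) (ξ i)‖ : ℂ) ^ 2 + (‖∑ i, ((s (a'' i))†) (ξ i)‖ : ℂ) ^ 2 =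
        (‖d‖ : ℂ) ^ 2 * (‖∑ i, ((s (a i))†) (ξ i)‖ : ℂ) ^ 2 := by
      simp only [expand, ← Finset.sum_add_distrib, Finset.mul_sum, ← inner_add_right,
        ← add_apply, key]
      simp [inner_smul_right]
    exact_mod_cast this
  rw [hTv]
  refine (pow_le_pow_iff_left₀ (norm_nonneg _) (by positivity) two_ne_zero).1 ?_
  rw [mul_pow, ← total]
  exact le_add_of_nonneg_right (by positivity)

end IsInduced

end Pair

/-! ### The induced representation of `[M* M]` -/

section Induction

variable {H K L L' : Type*}
  [NormedAddCommGroup H] [InnerProductSpace ℂ H] [CompleteSpace H]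
  [NormedAddCommGroup K] [InnerProductSpace ℂ K] [CompleteSpace K]
  [NormedAddCommGroup L] [InnerProductSpace ℂ L] [CompleteSpace L]
  [NormedAddCommGroup L'] [InnerProductSpace ℂ L'] [CompleteSpace L']
  {M : Submodule ℂ (H →L[ℂ] K)} {B : NonUnitalStarSubalgebra ℂ (K →L[ℂ] K)}
  {D : NonUnitalStarSubalgebra ℂ (H →L[ℂ] H)}

/-- `unitRow` as a family of elements of `M`. -/
noncomputable def TROPair.row (hP : TROPair M B D) (l : Finset M × ℕ) (k : l.1) : M :=
  ⟨unitRow l k, hP.tro.unitRow_mem l k⟩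

theorem adjoint_approxUnit (l : Finset M × ℕ) : (approxUnit l)† = approxUnit l := by
  simp [approxUnit, ContinuousLinearMap.adjoint_comp]

namespace IsInduced

variable {σ : B →⋆ₙₐ[ℂ] (L →L[ℂ] L)} {s : M →ₗ[ℂ] (L' →L[ℂ] L)}

/-- Each term is `σ (m p*) σ (p n*) = σ (m p* p n*)`. Thus `∑ (s p)* s p` plays on `L'` the part of
the approximate unit, before any representation of `D` is at hand. -/
theorem compression_sum_row (hP : TROPair M B D) (hs : IsInduced σ s) (l : Finset M × ℕ)
    (m n : M) (b : B) (hb : (b : K →L[ℂ] K) = m ∘L approxUnit l ∘L (n : H →L[ℂ] K)†) :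
    s m ∘L (∑ k, (s (hP.row l k))† ∘L s (hP.row l k)) ∘L (s n)† = σ b := by
  have h1 : b = ∑ k, (⟨_, hP.left_mem m.2 (hP.row l k).2⟩ : B) *
      ⟨_, hP.left_mem (hP.row l k).2 n.2⟩ := by
    apply Subtype.ext
    rw [hb, approxUnit, AddSubmonoidClass.coe_finsetSum]
    simp only [ContinuousLinearMap.finsetSum_comp, ContinuousLinearMap.comp_finsetSum]
    rfl
  rw [h1, map_sum]
  simp only [ContinuousLinearMap.finsetSum_comp, ContinuousLinearMap.comp_finsetSum, map_mul]
  refine Finset.sum_congr rfl fun k _ => ?_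
  rw [← hs.mul m (hP.row l k) _ rfl, ← hs.mul (hP.row l k) n _ rfl]
  rfl

theorem sum_norm_row_le (hP : TROPair M B D) (hs : IsInduced σ s) (l : Finset M × ℕ) (u : L') :
    ∑ k, ‖s (hP.row l k) u‖ ^ 2 ≤ ‖u‖ ^ 2 := by
  refine sum_norm_sq_le_of_norm_sum_le ?_ u
  exact (hs.norm_le_of_compression hP (hP.approxUnit_mem l)
    (hs.compression_sum_row hP l)).trans (norm_approxUnit_le l)

/-- With `u` the approximate unit, these contractions send `(s m)* ξ` to `(s (m u))* ξ`, and `m u →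
m` in norm. Such vectors span a dense subspace. -/
theorem tendsto_sum_row (hP : TROPair M B D) (hs : IsInduced σ s) (v : L') :
    Tendsto (fun l => (∑ k, (s (hP.row l k))† ∘L s (hP.row l k)) v) atTop (𝓝 v) := by
  set E : Finset M × ℕ → L' →L[ℂ] L' := fun l => ∑ k, (s (hP.row l k))† ∘L s (hP.row l k) with hE
  have hE1 : ∀ l v, ‖E l v‖ ≤ ‖v‖ := fun l v => by
    have := (hs.norm_le_of_compression hP (hP.approxUnit_mem l)
      (hs.compression_sum_row hP l)).trans (norm_approxUnit_le l)
    simpa using ContinuousLinearMap.le_of_opNorm_le (E l) this v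
  refine tendsto_of_mem_ncl (fun l => (E l : L' →ₗ[ℂ] L')) hE1
    (S := {η | ∃ m ξ, η = ((s m)†) ξ}) ?_ (by rw [show ncl _ = ⊤ from hs.dense]; trivial)
  rintro _ ⟨m, ξ, rfl⟩
  have hc : ∀ l, E l (((s m)†) ξ) = ((s ⟨(m : H →L[ℂ] K) ∘L approxUnit l,
      hP.comp_right_mem m.2 (hP.approxUnit_mem l)⟩)†) ξ := fun l =>
    DFunLike.congr_fun (hs.comp_adjoint hP (hP.approxUnit_mem l) (hs.compression_sum_row hP l)
      m _ (by rw [adjoint_approxUnit])) ξ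
  simp only [ContinuousLinearMap.coe_coe, hc]
  have h1 : Tendsto (fun l => (⟨(m : H →L[ℂ] K) ∘L approxUnit l,
      hP.comp_right_mem m.2 (hP.approxUnit_mem l)⟩ : M)) atTop (𝓝 m) :=
    tendsto_subtype_rng.2 (tendsto_comp_approxUnit m.2)
  have h2 : Continuous fun m : M => ((s m)†) ξ :=
    (ContinuousLinearMap.apply ℂ L' ξ).continuous.comp
      ((ContinuousLinearMap.adjoint (𝕜 := ℂ)).continuous.comp (hs.continuous hP))
  exact (h2.tendsto _).comp h1

/-- The representation of `D = [M* M]` on the induced space. -/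
theorem exists_right_rep (hP : TROPair M B D) (hs : IsInduced σ s) :
    ∃ τ : D →⋆ₙₐ[ℂ] (L' →L[ℂ] L'), ∀ (m n : M) (d : D) (b : B),
      (b : K →L[ℂ] K) = m ∘L (d : H →L[ℂ] H) ∘L (n : H →L[ℂ] K)† →
        s m ∘L τ d ∘L (s n)† = σ b := by
  have hU : D.toSubmodule = ncl (rightProducts M) := Submodule.ext hP.mem_right
  let Θ : M × M → (L' →L[ℂ] L') →L[ℂ] (L →L[ℂ] L) := fun j =>
    ContinuousLinearMap.compL ℂ L L' L (s j.1) ∘L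
      (ContinuousLinearMap.compL ℂ L L' L').flip ((s j.2)†)
  let f : M × M → D.toSubmodule →L[ℂ] (L →L[ℂ] L) := fun j =>
    repCLM hP.isClosed_left σ ∘L sandwich D.toSubmodule B.toSubmodule j.1 ((j.2 : H →L[ℂ] K)†)
      fun d hd => hP.sandwich_mem j.1.2 j.2.2 hd
  have hf : ∀ j d, f j d = σ ⟨_, hP.sandwich_mem j.1.2 j.2.2 d.2⟩ := fun _ _ => rfl
  have hΘ : ∀ j T, Θ j T = s j.1 ∘L T ∘L (s j.2)† := fun _ _ => rfl
  obtain ⟨F, hF⟩ := exists_linearMap_of_equations hU Θ f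
    (fun d T h => hs.norm_le_of_compression hP d.2 fun m n b hb => by
      have := h (m, n)
      rw [hf, hΘ] at this
      rw [this]; congr 1; exact Subtype.ext hb.symm)
    (by
      rintro ⟨d, hd'⟩ ⟨p, hp, q, hq, rfl⟩
      -- For `d = p* q` both sides are `σ (m p*) σ (q n*)`.
      refine ⟨(s ⟨p, hp⟩)† ∘L s ⟨q, hq⟩, fun j => ?_⟩
      rw [hΘ, hf]
      have h1 := hs.mul j.1 ⟨p, hp⟩ ⟨_, hP.left_mem j.1.2 hp⟩ rfl
      have h2 := hs.mul ⟨q, hq⟩ j.2 ⟨_, hP.left_mem hq j.2.2⟩ rfl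
      calc _ = (s j.1 ∘L (s ⟨p, hp⟩)†) ∘L (s ⟨q, hq⟩ ∘L (s j.2)†) := rfl
        _ = _ := by
          rw [h1, h2, ← ContinuousLinearMap.mul_def, ← map_mul]; rfl)
  have key : ∀ (m n : M) (d : D) (b : B),
      (b : K →L[ℂ] K) = m ∘L (d : H →L[ℂ] H) ∘L (n : H →L[ℂ] K)† →
        s m ∘L F ⟨d, d.2⟩ ∘L (s n)† = σ b := by
    intro m n d b hb
    have := hF (m, n) ⟨d, d.2⟩
    rw [hf, hΘ] at this
    rw [this]; congr 1; exact Subtype.ext hb.symm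
  have ext' : ∀ {S T : L' →L[ℂ] L'},
      (∀ m n : M, s m ∘L S ∘L (s n)† = s m ∘L T ∘L (s n)†) → S = T := fun {S T} h =>
    hs.dense.ext fun n => hs.dense.ext_left fun m => by
      simpa only [ContinuousLinearMap.adjoint_adjoint] using h m n
  refine ⟨{ toFun := fun d => F ⟨d, d.2⟩
            map_smul' := fun c d => F.map_smul c ⟨d, d.2⟩
            map_zero' := F.map_zero
            map_add' := fun d d' => F.map_add ⟨d, d.2⟩ ⟨d', d'.2⟩
            map_mul' := fun d d' => ?_
            map_star' := fun d => ?_ }, key⟩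
  · refine ext' fun m n => ?_
    rw [key m n _ ⟨_, hP.sandwich_mem m.2 n.2 (d * d').2⟩ rfl]
    have hd' : (d' : H →L[ℂ] H)† ∈ D := star_mem (s := D) d'.2
    -- The right factor is absorbed by `τ d' (s n)* = (s (n d'*))*`, which leaves a compression of
    -- `τ d` alone.
    let n' : M := ⟨(n : H →L[ℂ] K) ∘L (d' : H →L[ℂ] H)†, hP.comp_right_mem n.2 hd'⟩
    have h1 := hs.comp_adjoint hP d'.2 (fun m n b hb => key m n d' b hb) n n' rfl
    rw [ContinuousLinearMap.mul_def, ContinuousLinearMap.comp_assoc, h1,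
      key m n' d ⟨_, hP.sandwich_mem m.2 n'.2 d.2⟩ rfl]
    congr 2
    simp [n', ContinuousLinearMap.adjoint_comp, ContinuousLinearMap.mul_def,
      ContinuousLinearMap.comp_assoc]
  · refine ext' fun m n => ?_
    rw [key m n _ ⟨_, hP.sandwich_mem m.2 n.2 (star d).2⟩ rfl]
    have h1 := congrArg star (key n m d ⟨_, hP.sandwich_mem n.2 m.2 d.2⟩ rfl)
    rw [← map_star] at h1
    simp only [ContinuousLinearMap.star_eq_adjoint, ContinuousLinearMap.adjoint_comp,
      ContinuousLinearMap.adjoint_adjoint, ContinuousLinearMap.comp_assoc] at h1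
    rw [ContinuousLinearMap.star_eq_adjoint, h1]
    congr 1
    apply Subtype.ext
    simp [ContinuousLinearMap.star_eq_adjoint, ContinuousLinearMap.adjoint_comp,
      ContinuousLinearMap.comp_assoc]

end IsInduced

end Induction

/-! ### Construction of the induced Hilbert space -/

section InducedSpace

variable {H K L : Type u}
  [NormedAddCommGroup H] [InnerProductSpace ℂ H] [CompleteSpace H]
  [NormedAddCommGroup K] [InnerProductSpace ℂ K] [CompleteSpace K]
  [NormedAddCommGroup L] [InnerProductSpace ℂ L] [CompleteSpace L]
  {M : Submodule ℂ (H →L[ℂ] K)} {B : NonUnitalStarSubalgebra ℂ (K →L[ℂ] K)}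
  {D : NonUnitalStarSubalgebra ℂ (H →L[ℂ] H)}

/-- The kernel `(m, n) ↦ σ (m n*)` on `M`. -/
noncomputable def TROPair.kernel (hP : TROPair M B D) (σ : B →⋆ₙₐ[ℂ] (L →L[ℂ] L)) :
    Matrix M M (L →L[ℂ] L) :=
  .of fun m n => σ ⟨_, hP.left_mem m.2 n.2⟩

theorem TROPair.kernel_apply (hP : TROPair M B D) (σ : B →⋆ₙₐ[ℂ] (L →L[ℂ] L)) (m n : M) (b : B)
    (hb : (b : K →L[ℂ] K) = m ∘L (n : H →L[ℂ] K)†) : hP.kernel σ m n = σ b := by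
  simp only [kernel, Matrix.of_apply]
  congr 1
  exact Subtype.ext hb.symm

theorem TROPair.adjoint_kernel (hP : TROPair M B D) (σ : B →⋆ₙₐ[ℂ] (L →L[ℂ] L)) (m n : M) :
    (hP.kernel σ m n)† = hP.kernel σ n m := by
  have h1 := map_star σ (⟨_, hP.left_mem m.2 n.2⟩ : B)
  rw [← hP.kernel_apply σ n m _ (by
    simp [ContinuousLinearMap.star_eq_adjoint, ContinuousLinearMap.adjoint_comp])] at h1
  exact h1.symm

/-- With `u = ∑ p* p` an approximate unit, `σ (m u n*) = ∑ σ (p m*)* σ (p n*)` is a sum of Gram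
kernels, and it converges in norm to `σ (m n*)`. -/
theorem TROPair.posSemidef_kernel (hP : TROPair M B D) (σ : B →⋆ₙₐ[ℂ] (L →L[ℂ] L)) :
    (hP.kernel σ).PosSemidef := by
  have htfae := (RKHS.posSemidef_tfae (K := hP.kernel σ)).out 0 2
  refine htfae.2 ⟨?_, fun vv => ?_⟩
  · ext1 m n
    exact hP.adjoint_kernel σ n m
  · let g : Finset M × ℕ → M → M := fun l m =>
      ⟨_, hP.comp_right_mem m.2 (hP.approxUnit_mem l)⟩
    have hg : ∀ m, Tendsto (fun l => g l m) atTop (𝓝 m) := fun m =>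
      tendsto_subtype_rng.2 (tendsto_comp_approxUnit m.2)
    have hc : ∀ n, Continuous fun m => hP.kernel σ m n := fun n => by
      have h1 : Continuous fun m : M =>
          (⟨_, hP.left_mem m.2 n.2⟩ : B.toSubmodule) :=
        Continuous.subtype_mk (((ContinuousLinearMap.compL ℂ K H K).flip
          ((n : H →L[ℂ] K)†)).continuous.comp continuous_subtype_val) _
      exact (repCLM hP.isClosed_left σ).continuous.comp h1
    have hlim : Tendsto (fun l => RCLike.re (vv.sum fun m w => vv.sum fun m' w' =>
        inner ℂ (hP.kernel σ (g l m') m w) w')) atTop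
        (𝓝 (RCLike.re (vv.sum fun m w => vv.sum fun m' w' =>
          inner ℂ (hP.kernel σ m' m w) w'))) := by
      refine (RCLike.continuous_re.tendsto _).comp ?_
      refine tendsto_finsetSum _ fun m _ => tendsto_finsetSum _ fun m' _ => ?_
      have h1 := ((hc m).tendsto m').comp (hg m')
      exact Tendsto.inner (((ContinuousLinearMap.apply ℂ L (vv m)).continuous.tendsto _).comp h1)
        tendsto_const_nhds
    have : (atTop : Filter (Finset M × ℕ)).NeBot := by
      classical exact atTop_neBot
    refine ge_of_tendsto' hlim fun l => ?_
    have hk : ∀ m m' : M, hP.kernel σ (g l m') m =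
        ∑ k, hP.kernel σ m' (hP.row l k) ∘L hP.kernel σ (hP.row l k) m := by
      intro m m'
      have h1 : (⟨_, hP.left_mem (g l m').2 m.2⟩ : B) =
          ∑ k, (⟨_, hP.left_mem m'.2 (hP.row l k).2⟩ : B) *
            ⟨_, hP.left_mem (hP.row l k).2 m.2⟩ := by
        apply Subtype.ext
        rw [AddSubmonoidClass.coe_finsetSum]
        simp only [g, approxUnit, ContinuousLinearMap.finsetSum_comp,
          ContinuousLinearMap.comp_finsetSum]
        rfl
      simp only [TROPair.kernel, Matrix.of_apply]
      rw [h1, map_sum]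
      simp only [map_mul]
      rfl
    -- The form of the regularised kernel is a sum of squared norms, one for each row element.
    have hs : (vv.sum fun m w => vv.sum fun m' w' => inner ℂ (hP.kernel σ (g l m') m w) w') =
        ∑ k, inner ℂ (vv.sum fun m w => hP.kernel σ (hP.row l k) m w)
          (vv.sum fun m w => hP.kernel σ (hP.row l k) m w) := by
      simp only [hk, Finsupp.sum, sum_inner, inner_sum, sum_apply,
        ContinuousLinearMap.comp_apply]
      simp only [← hP.adjoint_kernel σ (hP.row l _) _, ContinuousLinearMap.adjoint_inner_left]
      rw [Finset.sum_comm]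
      symm
      rw [Finset.sum_comm]
      refine Finset.sum_congr rfl fun m _ => ?_
      rw [Finset.sum_comm]
    rw [hs, map_sum]
    exact Finset.sum_nonneg fun k _ => inner_self_nonneg

/-- The induced space exists. -/
theorem TROPair.exists_isInduced (hP : TROPair M B D) (σ : B →⋆ₙₐ[ℂ] (L →L[ℂ] L)) :
    ∃ (L' : Type u) (_ : NormedAddCommGroup L') (_ : InnerProductSpace ℂ L')
      (_ : CompleteSpace L') (s : M →ₗ[ℂ] (L' →L[ℂ] L)), IsInduced σ s := by
  have hpos : Fact (hP.kernel σ).PosSemidef := ⟨hP.posSemidef_kernel σ⟩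
  -- The reproducing kernel space of the kernel supplies `v m : L → L'` with `(v m)* v n = σ (m n*)`
  -- and dense ranges. Here `v` is conjugate-linear in `m`, so `s m = (v m)*` is linear.
  let L' : Type u := RKHS.OfKernel (hP.kernel σ)
  let v : M → L →L[ℂ] L' := RKHS.kerFun L'
  have hv : ∀ m n, (v m)† ∘L v n = hP.kernel σ m n := fun m n => by
    exact (RKHS.kernel_apply L' m n).symm.trans
      (congrFun₂ (RKHS.OfKernel.kernel_ofKernel (K := hP.kernel σ)) m n)
  have hd : DenseRanges v := by
    have := RKHS.kerFun_dense L'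
    rw [DenseRanges, ← this, ncl]
    congr 2
    ext η
    simp [v, eq_comm]
  have hadd : ∀ m n, v (m + n) = v m + v n := fun m n => hd.ext_left fun p => by
    rw [ContinuousLinearMap.comp_add, hv, hv, hv,
      hP.kernel_apply σ p (m + n) (⟨_, hP.left_mem p.2 m.2⟩ + ⟨_, hP.left_mem p.2 n.2⟩)
        (by simp), map_add]
    rfl
  have hsmul : ∀ (c : ℂ) m, v (c • m) = (starRingEnd ℂ c) • v m := fun c m =>
    hd.ext_left fun p => by
      rw [ContinuousLinearMap.comp_smul, hv, hv,
        hP.kernel_apply σ p (c • m) (starRingEnd ℂ c • ⟨_, hP.left_mem p.2 m.2⟩)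
          (by simp [map_smulₛₗ]), map_smul]
      rfl
  refine ⟨L', inferInstance, inferInstance, inferInstance,
    { toFun := fun m => (v m)†
      map_add' := fun m n => by rw [hadd, map_add]
      map_smul' := fun c m => by simp [hsmul, map_smulₛₗ] }, ?_, ?_⟩
  · intro m n b hb
    simpa [hv] using hP.kernel_apply σ m n b hb
  · simpa using hd

end InducedSpace

/-! ### Norms of operator matrices through sesquilinear forms -/

section MatrixBounds

variable {E F E' F' : Type*}
  [NormedAddCommGroup E] [InnerProductSpace ℂ E]
  [NormedAddCommGroup F] [InnerProductSpace ℂ F]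
  [NormedAddCommGroup E'] [InnerProductSpace ℂ E']
  [NormedAddCommGroup F'] [InnerProductSpace ℂ F']
  {ι κ ι' κ' : Type*} [Fintype ι] [Fintype κ] [Fintype ι'] [Fintype κ']

theorem norm_inner_self (v : E) : ‖(inner ℂ v v : ℂ)‖ = ‖v‖ * ‖v‖ := by
  rw [inner_self_eq_norm_sq_to_K, norm_pow, RCLike.norm_ofReal, abs_norm, pow_two]

/-- The operator matrix `x` has norm at most `C`, in terms of its sesquilinear form. -/
def MatBound (x : ι → κ → E →L[ℂ] F) (C : ℝ) : Prop :=
  ∀ (v : κ → E) (w : ι → F), ‖∑ i, ∑ j, (inner ℂ (w i) (x i j (v j)) : ℂ)‖ ≤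
    C * √(∑ j, ‖v j‖ ^ 2) * √(∑ i, ‖w i‖ ^ 2)

/-- The form version allows rectangular matrices over arbitrary finite index types, which arise when
each entry is expanded along finite rows of a TRO. -/
theorem norm_opMatrix_le_iff {n : ℕ} (x : Fin n → Fin n → E →L[ℂ] F) {C : ℝ} (hC : 0 ≤ C) :
    ‖opMatrix x‖ ≤ C ↔ MatBound x C := by
  have hin : ∀ (v : PiLp 2 fun _ : Fin n => E) (w : PiLp 2 fun _ : Fin n => F),
      inner ℂ w (opMatrix x v) = ∑ i, ∑ j, (inner ℂ (w i) (x i j (v j)) : ℂ) := by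
    intro v w
    simp only [PiLp.inner_apply, opMatrix_apply, inner_sum]
  constructor
  · intro h v w
    have h1 := hin (WithLp.toLp 2 v) (WithLp.toLp 2 w)
    simp only at h1
    rw [← h1]
    refine (norm_inner_le_norm _ _).trans ?_
    rw [mul_comm]
    have hv : ‖(WithLp.toLp 2 v : PiLp 2 fun _ : Fin n => E)‖ = √(∑ j, ‖v j‖ ^ 2) := by
      simp [PiLp.norm_eq_of_L2]
    have hw : ‖(WithLp.toLp 2 w : PiLp 2 fun _ : Fin n => F)‖ = √(∑ j, ‖w j‖ ^ 2) := by
      simp [PiLp.norm_eq_of_L2]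
    rw [hw, ← hv]
    gcongr
    exact ContinuousLinearMap.le_of_opNorm_le _ h _
  · intro h
    refine ContinuousLinearMap.opNorm_le_bound _ hC fun v => ?_
    -- Testing against `w = x v` yields `‖x v‖² ≤ C ‖v‖ ‖x v‖`.
    have h1 := h v (opMatrix x v)
    rw [← hin, ← PiLp.norm_eq_of_L2, ← PiLp.norm_eq_of_L2, norm_inner_self] at h1
    rcases (norm_nonneg (opMatrix x v)).eq_or_lt with h0 | h0
    · rw [← h0]; positivity
    · exact le_of_mul_le_mul_right h1 h0

theorem matBound_norm {n : ℕ} (x : Fin n → Fin n → E →L[ℂ] F) : MatBound x ‖opMatrix x‖ :=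
  (norm_opMatrix_le_iff x (norm_nonneg (opMatrix x))).1 le_rfl

namespace MatBound

theorem reindex {x : ι → κ → E →L[ℂ] F} {C : ℝ} (h : MatBound x C) (e : ι' ≃ ι) (f : κ' ≃ κ) :
    MatBound (fun i j => x (e i) (f j)) C := by
  intro v w
  have h1 := h (v ∘ f.symm) (w ∘ e.symm)
  rw [← Equiv.sum_comp e, ← Equiv.sum_comp e, ← Equiv.sum_comp f] at h1
  simp only [← Equiv.sum_comp f (fun j => inner ℂ _ (x _ j _))] at h1
  simpa using h1

theorem reindex_iff {x : ι → κ → E →L[ℂ] F} {C : ℝ} (e : ι' ≃ ι) (f : κ' ≃ κ) :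
    MatBound (fun i j => x (e i) (f j)) C ↔ MatBound x C :=
  ⟨fun h => by simpa using h.reindex e.symm f.symm, fun h => h.reindex e f⟩

/-- The rectangular matrix `x` as a corner of a square matrix. -/
def corner {V : Type*} [Zero V] (x : ι → κ → V) : ι ⊕ κ → ι ⊕ κ → V
  | .inl i, .inr j => x i j
  | _, _ => 0

theorem corner_iff (x : ι → κ → E →L[ℂ] F) {C : ℝ} (hC : 0 ≤ C) :
    MatBound (corner x) C ↔ MatBound x C := by
  constructor
  · intro h v w
    simpa [corner] using h (Sum.elim 0 v) (Sum.elim w 0)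
  · intro h v w
    have h1 := h (v ∘ .inr) (w ∘ .inl)
    simp only [Fintype.sum_sum_type, corner]
    simp only [zero_apply, inner_zero_right, Finset.sum_const_zero, zero_add, add_zero]
    refine h1.trans ?_
    gcongr
    · exact le_add_of_nonneg_left (by positivity)
    · exact le_add_of_nonneg_right (by positivity)

theorem of_tendsto {Λ : Type*} {l : Filter Λ} [l.NeBot] {T : Λ → ι → κ → E →L[ℂ] F}
    {S : ι → κ → E →L[ℂ] F} {C : ℝ} (h : ∀ k, MatBound (T k) C)
    (hT : ∀ i j v, Tendsto (fun k => T k i j v) l (𝓝 (S i j v))) : MatBound S C := by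
  intro v w
  refine le_of_tendsto' (x := l) (f := fun k => ‖∑ i, ∑ j, (inner ℂ (w i) (T k i j (v j)) : ℂ)‖)
    ?_ fun k => h k v w
  refine Tendsto.norm (tendsto_finsetSum _ fun i _ => tendsto_finsetSum _ fun j _ => ?_)
  exact tendsto_const_nhds.inner (hT i j (v j))

section Compression

variable [CompleteSpace E] [CompleteSpace F] [CompleteSpace E'] [CompleteSpace F']
  {ι₁ κ₁ : Type*} [Fintype ι₁] [Fintype κ₁]

/-- The adjoint of a column contraction is a row contraction. By Cauchy–Schwarz, `u = ∑ (a l)* (v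
l)` satisfies `‖u‖⁴ ≤ ‖u‖² ∑ ‖v l‖²`. -/
theorem norm_sum_adjoint_sq_le {a : κ₁ → E →L[ℂ] E'}
    (ha : ∀ u, ∑ l, ‖a l u‖ ^ 2 ≤ ‖u‖ ^ 2) (v : κ₁ → E') :
    ‖∑ l, ((a l)†) (v l)‖ ^ 2 ≤ ∑ l, ‖v l‖ ^ 2 := by
  set u := ∑ l, ((a l)†) (v l) with hu
  have h1 : ‖u‖ ^ 2 ≤ ∑ l, ‖a l u‖ * ‖v l‖ := by
    have : (inner ℂ u u : ℂ) = ∑ l, inner ℂ (a l u) (v l) := by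
      conv_lhs => enter [3]; rw [hu]
      simp [ContinuousLinearMap.adjoint_inner_right]
    calc ‖u‖ ^ 2 = ‖(inner ℂ u u : ℂ)‖ := by rw [norm_inner_self, pow_two]
      _ ≤ _ := by
        rw [this]
        exact (norm_sum_le _ _).trans (Finset.sum_le_sum fun l _ => norm_inner_le_norm _ _)
  have h2 := Finset.sum_mul_sq_le_sq_mul_sq Finset.univ (fun l => ‖a l u‖) (fun l => ‖v l‖)
  have h3 : (‖u‖ ^ 2) ^ 2 ≤ ‖u‖ ^ 2 * ∑ l, ‖v l‖ ^ 2 :=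
    calc (‖u‖ ^ 2) ^ 2 ≤ (∑ l, ‖a l u‖ * ‖v l‖) ^ 2 := by gcongr
      _ ≤ (∑ l, ‖a l u‖ ^ 2) * ∑ l, ‖v l‖ ^ 2 := h2
      _ ≤ _ := by gcongr; exact ha u
  rcases (sq_nonneg ‖u‖).eq_or_lt with h0 | h0
  · rw [← h0]; positivity
  · rw [pow_two] at h3
    exact le_of_mul_le_mul_left h3 h0

/-- The form of the enlarged matrix at `(v, w)` is the form of `x` at the vectors `∑ (a l)* v (j,
l)` and `∑ (b k)* w (i, k)`, which are no longer in total. -/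
theorem compress {x : ι → κ → E →L[ℂ] F} {C : ℝ} (hC : 0 ≤ C) (h : MatBound x C)
    {a : κ₁ → E →L[ℂ] E'} {b : ι₁ → F →L[ℂ] F'}
    (ha : ∀ u, ∑ l, ‖a l u‖ ^ 2 ≤ ‖u‖ ^ 2) (hb : ∀ u, ∑ l, ‖b l u‖ ^ 2 ≤ ‖u‖ ^ 2) :
    MatBound (fun (i : ι × ι₁) (j : κ × κ₁) => b i.2 ∘L x i.1 j.1 ∘L (a j.2)†) C := by
  intro v w
  have h1 := h (fun j => ∑ l, ((a l)†) (v (j, l))) (fun i => ∑ k, ((b k)†) (w (i, k)))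
  have h2 : ∑ i, ∑ j, (inner ℂ (∑ k, ((b k)†) (w (i, k))) (x i j (∑ l, ((a l)†) (v (j, l)))) : ℂ) =
      ∑ i : ι × ι₁, ∑ j : κ × κ₁, inner ℂ (w i) ((b i.2 ∘L x i.1 j.1 ∘L (a j.2)†) (v j)) := by
    simp only [Fintype.sum_prod_type, map_sum, sum_inner, inner_sum,
      ContinuousLinearMap.adjoint_inner_left, ContinuousLinearMap.comp_apply]
    refine Finset.sum_congr rfl fun i _ => ?_
    rw [Finset.sum_comm]
    rw [Finset.sum_comm]
    conv_rhs => rw [Finset.sum_comm]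
    exact Finset.sum_congr rfl fun j _ => Finset.sum_comm
  rw [← h2]
  refine h1.trans ?_
  gcongr
  · rw [Fintype.sum_prod_type]
    exact Finset.sum_le_sum fun j _ => norm_sum_adjoint_sq_le ha _
  · rw [Fintype.sum_prod_type]
    exact Finset.sum_le_sum fun j _ => norm_sum_adjoint_sq_le hb _

/-- The form of the new matrix at `(v, w)` is that of the enlarged matrix at the vectors `a l (v j)`
and `b k (w i)`. -/
theorem decompress {x : ι → κ → E →L[ℂ] F} {C : ℝ} (hC : 0 ≤ C)
    {a : κ₁ → E →L[ℂ] E'} {b : ι₁ → F →L[ℂ] F'}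
    (h : MatBound (fun (i : ι × ι₁) (j : κ × κ₁) => b i.2 ∘L x i.1 j.1 ∘L (a j.2)†) C)
    (ha : ∀ u, ∑ l, ‖a l u‖ ^ 2 ≤ ‖u‖ ^ 2) (hb : ∀ u, ∑ l, ‖b l u‖ ^ 2 ≤ ‖u‖ ^ 2) :
    MatBound (fun i j => (∑ k, (b k)† ∘L b k) ∘L x i j ∘L (∑ l, (a l)† ∘L a l)) C := by
  intro v w
  have h1 := h (fun j => a j.2 (v j.1)) (fun i => b i.2 (w i.1))
  have h2 : ∑ i : ι × ι₁, ∑ j : κ × κ₁, (inner ℂ (b i.2 (w i.1))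
      ((b i.2 ∘L x i.1 j.1 ∘L (a j.2)†) (a j.2 (v j.1))) : ℂ) =
      ∑ i, ∑ j, inner ℂ (w i)
        (((∑ k, (b k)† ∘L b k) ∘L x i j ∘L (∑ l, (a l)† ∘L a l)) (v j)) := by
    simp only [Fintype.sum_prod_type, ContinuousLinearMap.comp_apply, sum_apply, map_sum, inner_sum,
      ContinuousLinearMap.adjoint_inner_right]
    refine Finset.sum_congr rfl fun i _ => ?_
    rw [Finset.sum_comm]
    exact Finset.sum_congr rfl fun j _ => Finset.sum_comm
  have h3 : ∑ j : κ × κ₁, ‖a j.2 (v j.1)‖ ^ 2 ≤ ∑ j, ‖v j‖ ^ 2 := by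
    rw [Fintype.sum_prod_type]
    exact Finset.sum_le_sum fun j _ => ha (v j)
  have h4 : ∑ i : ι × ι₁, ‖b i.2 (w i.1)‖ ^ 2 ≤ ∑ i, ‖w i‖ ^ 2 := by
    rw [Fintype.sum_prod_type]
    exact Finset.sum_le_sum fun i _ => hb (w i)
  rw [h2] at h1
  refine h1.trans ?_
  gcongr

end Compression

end MatBound

variable {X : Submodule ℂ (E →L[ℂ] F)} {φ : X →ₗ[ℂ] (E' →L[ℂ] F')}

theorem completelyContractive_iff : CompletelyContractive φ ↔
    ∀ (n : ℕ) (x : Fin n → Fin n → X) (C : ℝ), 0 ≤ C →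
      MatBound (fun i j => (x i j : E →L[ℂ] F)) C → MatBound (fun i j => φ (x i j)) C := by
  constructor
  · intro h n x C hC hx
    rw [← norm_opMatrix_le_iff _ hC] at hx ⊢
    exact (h n x).trans hx
  · intro h n x
    exact (norm_opMatrix_le_iff _ (ContinuousLinearMap.opNorm_nonneg _)).2 <|
      h n x _ (ContinuousLinearMap.opNorm_nonneg _) (matBound_norm _)

theorem completelyIsometric_iff : CompletelyIsometric φ ↔
    ∀ (n : ℕ) (x : Fin n → Fin n → X) (C : ℝ), 0 ≤ C →
      (MatBound (fun i j => φ (x i j)) C ↔ MatBound (fun i j => (x i j : E →L[ℂ] F)) C) := by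
  constructor
  · intro h n x C hC
    rw [← norm_opMatrix_le_iff _ hC, ← norm_opMatrix_le_iff _ hC, h n x]
  · intro h n x
    refine le_antisymm ?_ ?_
    · exact (norm_opMatrix_le_iff _ (ContinuousLinearMap.opNorm_nonneg _)).2 <|
        (h n x _ (ContinuousLinearMap.opNorm_nonneg _)).2 (matBound_norm _)
    · exact (norm_opMatrix_le_iff _ (ContinuousLinearMap.opNorm_nonneg _)).2 <|
        (h n x _ (ContinuousLinearMap.opNorm_nonneg _)).1 (matBound_norm _)

/-- Passing from a rectangular matrix of elements of `X` to a square one. -/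
theorem exists_square (x : ι → κ → X) : ∃ (n : ℕ) (x' : Fin n → Fin n → X),
    ∀ C, 0 ≤ C →
      (MatBound (fun i j => (x' i j : E →L[ℂ] F)) C ↔
        MatBound (fun i j => (x i j : E →L[ℂ] F)) C) ∧
      (MatBound (fun i j => φ (x' i j)) C ↔ MatBound (fun i j => φ (x i j)) C) := by
  obtain ⟨n, ⟨e⟩⟩ : ∃ n, Nonempty (Fin n ≃ ι ⊕ κ) := ⟨_, ⟨(Fintype.equivFin _).symm⟩⟩
  refine ⟨n, fun i j => MatBound.corner x (e i) (e j), fun C hC => ?_⟩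
  have h1 : (fun i j => ((MatBound.corner x i j : X) : E →L[ℂ] F)) =
      MatBound.corner fun i j => (x i j : E →L[ℂ] F) := by
    ext1 i; ext1 j; rcases i with i | i <;> rcases j with j | j <;> simp [MatBound.corner]
  have h2 : (fun i j => φ (MatBound.corner x i j)) = MatBound.corner fun i j => φ (x i j) := by
    ext1 i; ext1 j; rcases i with i | i <;> rcases j with j | j <;> simp [MatBound.corner]
  rw [← MatBound.corner_iff (fun i j => (x i j : E →L[ℂ] F)) hC, ← h1,
    ← MatBound.corner_iff (fun i j => φ (x i j)) hC, ← h2]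
  have r1 := MatBound.reindex_iff (C := C)
    (x := fun i j => ((MatBound.corner x i j : X) : E →L[ℂ] F)) e e
  have r2 := MatBound.reindex_iff (C := C) (x := fun i j => φ (MatBound.corner x i j)) e e
  exact ⟨r1, r2⟩

theorem CompletelyContractive.matBound (h : CompletelyContractive φ) (x : ι → κ → X) {C : ℝ}
    (hC : 0 ≤ C) (hx : MatBound (fun i j => (x i j : E →L[ℂ] F)) C) :
    MatBound (fun i j => φ (x i j)) C := by
  obtain ⟨n, x', hx'⟩ := exists_square (φ := φ) x
  rw [← (hx' C hC).2]
  exact completelyContractive_iff.1 h n x' C hC ((hx' C hC).1.2 hx)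

theorem CompletelyIsometric.matBound (h : CompletelyIsometric φ) (x : ι → κ → X) {C : ℝ}
    (hC : 0 ≤ C) (hx : MatBound (fun i j => φ (x i j)) C) :
    MatBound (fun i j => (x i j : E →L[ℂ] F)) C := by
  obtain ⟨n, x', hx'⟩ := exists_square (φ := φ) x
  rw [← (hx' C hC).1]
  exact (completelyIsometric_iff.1 h n x' C hC).1 ((hx' C hC).2.2 hx)

theorem matBound_unique_iff {ι : Type*} [Unique ι] (T : E →L[ℂ] F) {C : ℝ} (hC : 0 ≤ C) :
    MatBound (fun _ _ : ι => T) C ↔ ‖T‖ ≤ C := by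
  constructor
  · intro h
    refine ContinuousLinearMap.opNorm_le_bound _ hC fun v => ?_
    have h1 := h (fun _ => v) (fun _ => T v)
    simp only [Finset.univ_unique, Finset.sum_singleton, norm_inner_self,
      Real.sqrt_sq (norm_nonneg _)] at h1
    rcases (norm_nonneg (T v)).eq_or_lt with h0 | h0
    · rw [← h0]; positivity
    · exact le_of_mul_le_mul_right h1 h0
  · intro h v w
    simp only [Finset.univ_unique, Finset.sum_singleton, Real.sqrt_sq (norm_nonneg _)]
    refine (norm_inner_le_norm _ _).trans ?_
    rw [mul_comm]
    gcongr
    exact ContinuousLinearMap.le_of_opNorm_le _ h _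

theorem CompletelyContractive.norm_le (h : CompletelyContractive φ) (x : X) : ‖φ x‖ ≤ ‖x‖ := by
  refine (matBound_unique_iff (ι := Fin 1) _ (norm_nonneg _)).1 ?_
  exact h.matBound (fun _ _ => x) (norm_nonneg _)
    ((matBound_unique_iff (x : E →L[ℂ] F) (norm_nonneg _)).2 le_rfl)

end MatrixBounds

/-! ### Transfer of the operator space along the two TROs -/

section Linked

variable {H₁ H₂ K₁ K₂ : Type u}
  [NormedAddCommGroup H₁] [InnerProductSpace ℂ H₁] [CompleteSpace H₁]
  [NormedAddCommGroup H₂] [InnerProductSpace ℂ H₂] [CompleteSpace H₂]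
  [NormedAddCommGroup K₁] [InnerProductSpace ℂ K₁] [CompleteSpace K₁]
  [NormedAddCommGroup K₂] [InnerProductSpace ℂ K₂] [CompleteSpace K₂]

/-- The C*-bimodules `𝓔` and `𝓕` are those of a strong TRO equivalence by `M₁` and `M₂`. -/
structure Linked (𝓔 : CStarBimodule K₁ K₂) (𝓕 : CStarBimodule H₁ H₂)
    (M₁ : Submodule ℂ (H₁ →L[ℂ] K₁)) (M₂ : Submodule ℂ (H₂ →L[ℂ] K₂)) : Prop where
  right : TROPair M₁ 𝓔.B 𝓕.B
  left : TROPair M₂ 𝓔.A 𝓕.A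
  eq_left : 𝓔.X = ncl {T | ∃ m₂ ∈ M₂, ∃ y ∈ 𝓕.X, ∃ m₁ ∈ M₁, T = m₂ ∘L y ∘L m₁†}
  eq_right : 𝓕.X = ncl {T | ∃ m₂ ∈ M₂, ∃ x ∈ 𝓔.X, ∃ m₁ ∈ M₁, T = m₂† ∘L x ∘L m₁}

namespace Linked

variable {𝓔 : CStarBimodule K₁ K₂} {𝓕 : CStarBimodule H₁ H₂}
    {M₁ : Submodule ℂ (H₁ →L[ℂ] K₁)} {M₂ : Submodule ℂ (H₂ →L[ℂ] K₂)}

theorem symm (hL : Linked 𝓔 𝓕 M₁ M₂) : Linked 𝓕 𝓔 (adjointTRO M₁) (adjointTRO M₂) where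
  right := hL.right.symm
  left := hL.left.symm
  eq_left := by
    conv_lhs => rw [hL.eq_right]
    congr 1
    ext T
    constructor
    · rintro ⟨n, hn, x, hx, m, hm, rfl⟩
      exact ⟨n†, adjoint_mem_adjointTRO.2 hn, x, hx, m†, adjoint_mem_adjointTRO.2 hm, by simp⟩
    · rintro ⟨n, hn, x, hx, m, hm, rfl⟩
      exact ⟨n†, hn, x, hx, m†, hm, by simp⟩
  eq_right := by
    conv_lhs => rw [hL.eq_left]
    congr 1
    ext T
    constructor
    · rintro ⟨n, hn, x, hx, m, hm, rfl⟩
      exact ⟨n†, adjoint_mem_adjointTRO.2 hn, x, hx, m†, adjoint_mem_adjointTRO.2 hm, by simp⟩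
    · rintro ⟨n, hn, x, hx, m, hm, rfl⟩
      exact ⟨n†, hn, x, hx, m†, hm, by simp⟩

theorem mem_left (hL : Linked 𝓔 𝓕 M₁ M₂) {n : H₂ →L[ℂ] K₂} {y : H₁ →L[ℂ] H₂} {m : H₁ →L[ℂ] K₁}
    (hn : n ∈ M₂) (hy : y ∈ 𝓕.X) (hm : m ∈ M₁) : n ∘L y ∘L m† ∈ 𝓔.X := by
  rw [hL.eq_left]
  exact subset_ncl ⟨n, hn, y, hy, m, hm, rfl⟩

theorem mem_right (hL : Linked 𝓔 𝓕 M₁ M₂) {n : H₂ →L[ℂ] K₂} {x : K₁ →L[ℂ] K₂} {m : H₁ →L[ℂ] K₁}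
    (hn : n ∈ M₂) (hx : x ∈ 𝓔.X) (hm : m ∈ M₁) : n† ∘L x ∘L m ∈ 𝓕.X := by
  rw [hL.eq_right]
  exact subset_ncl ⟨n, hn, x, hx, m, hm, rfl⟩

/-- The generators `n* x m` of the space end in `m ∈ M₁`, on which the unit of `M₁` acts
approximately. -/
theorem tendsto_comp_approxUnit (hL : Linked 𝓔 𝓕 M₁ M₂) {y : H₁ →L[ℂ] H₂} (hy : y ∈ 𝓕.X) :
    Tendsto (fun l : Finset M₁ × ℕ => y ∘L approxUnit l) atTop (𝓝 y) := by
  rw [hL.eq_right] at hy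
  refine tendsto_of_mem_ncl (fun l : Finset M₁ × ℕ =>
    (((ContinuousLinearMap.compL ℂ H₁ H₁ H₂).flip (approxUnit l) :
      (H₁ →L[ℂ] H₂) →L[ℂ] (H₁ →L[ℂ] H₂)) : (H₁ →L[ℂ] H₂) →ₗ[ℂ] (H₁ →L[ℂ] H₂))) ?_ ?_ hy
  · intro l y
    calc ‖y ∘L approxUnit l‖ ≤ ‖y‖ * ‖approxUnit l‖ := ContinuousLinearMap.opNorm_comp_le _ _
      _ ≤ ‖y‖ * 1 := by gcongr; exact norm_approxUnit_le l
      _ = ‖y‖ := mul_one _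
  · rintro _ ⟨n, hn, x, hx, m, hm, rfl⟩
    have h1 : Tendsto (fun l : Finset M₁ × ℕ => (n† ∘L x) ∘L (m ∘L approxUnit l)) atTop
        (𝓝 ((n† ∘L x) ∘L m)) :=
      ((ContinuousLinearMap.compL ℂ H₁ K₁ H₂ (n† ∘L x)).continuous.tendsto m).comp
        (StrongTRO.tendsto_comp_approxUnit hm)
    change Tendsto (fun l : Finset M₁ × ℕ => (n† ∘L x ∘L m) ∘L approxUnit l) atTop _
    simpa only [ContinuousLinearMap.comp_assoc] using h1

theorem tendsto_approxUnit_comp (hL : Linked 𝓔 𝓕 M₁ M₂) {y : H₁ →L[ℂ] H₂} (hy : y ∈ 𝓕.X) :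
    Tendsto (fun l : Finset M₂ × ℕ => approxUnit l ∘L y) atTop (𝓝 y) := by
  rw [hL.eq_right] at hy
  refine tendsto_of_mem_ncl (fun l : Finset M₂ × ℕ =>
    ((ContinuousLinearMap.compL ℂ H₁ H₂ H₂ (approxUnit l) :
      (H₁ →L[ℂ] H₂) →L[ℂ] (H₁ →L[ℂ] H₂)) : (H₁ →L[ℂ] H₂) →ₗ[ℂ] (H₁ →L[ℂ] H₂))) ?_ ?_ hy
  · intro l y
    calc ‖approxUnit l ∘L y‖ ≤ ‖approxUnit l‖ * ‖y‖ := ContinuousLinearMap.opNorm_comp_le _ _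
      _ ≤ 1 * ‖y‖ := by gcongr; exact norm_approxUnit_le l
      _ = ‖y‖ := one_mul _
  · rintro _ ⟨n, hn, x, hx, m, hm, rfl⟩
    have h1 : Tendsto (fun l : Finset M₂ × ℕ => approxUnit l ∘L n†) atTop (𝓝 (n†)) := by
      have := ((ContinuousLinearMap.adjoint (𝕜 := ℂ)).continuous.tendsto n).comp
        (StrongTRO.tendsto_comp_approxUnit hn)
      refine this.congr fun l => ?_
      simp [ContinuousLinearMap.adjoint_comp, adjoint_approxUnit]
    have h2 : Tendsto (fun l : Finset M₂ × ℕ => (approxUnit l ∘L n†) ∘L (x ∘L m)) atTop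
        (𝓝 (n† ∘L (x ∘L m))) :=
      (((ContinuousLinearMap.compL ℂ H₁ K₂ H₂).flip (x ∘L m)).continuous.tendsto (n†)).comp h1
    change Tendsto (fun l : Finset M₂ × ℕ => approxUnit l ∘L (n† ∘L x ∘L m)) atTop _
    simpa only [ContinuousLinearMap.comp_assoc] using h2

section Transfer

variable {L₁' L₂' : Type u}
  [NormedAddCommGroup L₁'] [InnerProductSpace ℂ L₁'] [CompleteSpace L₁']
  [NormedAddCommGroup L₂'] [InnerProductSpace ℂ L₂'] [CompleteSpace L₂']
  {r : BimoduleMap 𝓔} {s : M₁ →ₗ[ℂ] (L₁' →L[ℂ] r.L₁)} {t : M₂ →ₗ[ℂ] (L₂' →L[ℂ] r.L₂)}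
  {ι κ : Type*} [Fintype ι] [Fintype κ]

/-- A matrix over `B(L₁', L₂')` that compresses to the matrix `φ (n y m*)` is bounded by `y`. -/
theorem matBound_of_compression (hL : Linked 𝓔 𝓕 M₁ M₂) (hs : IsInduced r.σ s)
    (ht : IsInduced r.π t) {y : ι → κ → 𝓕.X} {T : ι → κ → L₁' →L[ℂ] L₂'}
    (hT : ∀ i j (n : M₂) (m : M₁) (x : 𝓔.X), (x : K₁ →L[ℂ] K₂) =
      (n : H₂ →L[ℂ] K₂) ∘L (y i j : H₁ →L[ℂ] H₂) ∘L (m : H₁ →L[ℂ] K₁)† →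
        t n ∘L T i j ∘L (s m)† = r.φ x)
    {C : ℝ} (hC : 0 ≤ C) (hy : MatBound (fun i j => (y i j : H₁ →L[ℂ] H₂)) C) :
    MatBound T C := by
  have hn₁ : (atTop : Filter (Finset M₁ × ℕ)).NeBot := by classical exact atTop_neBot
  have hn₂ : (atTop : Filter (Finset M₂ × ℕ)).NeBot := by classical exact atTop_neBot
  have step : ∀ (l₁ : Finset M₁ × ℕ) (l₂ : Finset M₂ × ℕ), MatBound (fun i j =>
      (∑ k, (t (hL.left.row l₂ k))† ∘L t (hL.left.row l₂ k)) ∘L T i j ∘L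
        (∑ k, (s (hL.right.row l₁ k))† ∘L s (hL.right.row l₁ k))) C := by
    intro l₁ l₂
    refine MatBound.decompress hC ?_ (hs.sum_norm_row_le hL.right l₁) (ht.sum_norm_row_le hL.left l₂)
    -- The elements `q y p*` with `q`, `p` in the two unit rows: a compression of `y` in `B(K₁,
    -- K₂)`, whose image under `φ` is the matrix `t q T (s p)*`.
    let x : ι × l₂.1 → κ × l₁.1 → 𝓔.X := fun i j =>
      ⟨_, hL.mem_left (hL.left.row l₂ i.2).2 (y i.1 j.1).2 (hL.right.row l₁ j.2).2⟩
    have h1 : MatBound (fun i j => (x i j : K₁ →L[ℂ] K₂)) C :=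
      MatBound.compress hC hy
        (fun u => sum_norm_sq_le_of_norm_sum_le (p := unitRow l₁) (norm_approxUnit_le l₁) u)
        (fun u => sum_norm_sq_le_of_norm_sum_le (p := unitRow l₂) (norm_approxUnit_le l₂) u)
    have h2 := r.completelyContractive.matBound x hC h1
    have h3 : (fun (i : ι × l₂.1) (j : κ × l₁.1) => t (hL.left.row l₂ i.2) ∘L T i.1 j.1 ∘L
        (s (hL.right.row l₁ j.2))†) = fun i j => r.φ (x i j) := by
      ext1 i; ext1 j
      exact hT i.1 j.1 _ _ (x i j) rfl
    exact h3 ▸ h2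
  -- The strong limits are taken one at a time: `l₂` first with `l₁` fixed, then `l₁`.
  refine MatBound.of_tendsto (l := atTop) (fun l₁ => MatBound.of_tendsto (l := atTop) (step l₁)
    (S := fun i j => T i j ∘L (∑ k, (s (hL.right.row l₁ k))† ∘L s (hL.right.row l₁ k)))
    fun i j v => ht.tendsto_sum_row hL.left _) fun i j v => ?_
  exact ((T i j).continuous.tendsto v).comp (hs.tendsto_sum_row hL.right v)

/-- The argument of `matBound_of_compression` reversed: compress `T`, pull the bound back through
`φ`, and decompress with the approximate units of the concrete algebras. -/
theorem matBound_of_isometric (hL : Linked 𝓔 𝓕 M₁ M₂) (hs : IsInduced r.σ s)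
    (ht : IsInduced r.π t) (hr : CompletelyIsometric r.φ)
    {y : ι → κ → 𝓕.X} {T : ι → κ → L₁' →L[ℂ] L₂'}
    (hT : ∀ i j (n : M₂) (m : M₁) (x : 𝓔.X), (x : K₁ →L[ℂ] K₂) =
      (n : H₂ →L[ℂ] K₂) ∘L (y i j : H₁ →L[ℂ] H₂) ∘L (m : H₁ →L[ℂ] K₁)† →
        t n ∘L T i j ∘L (s m)† = r.φ x)
    {C : ℝ} (hC : 0 ≤ C) (hTC : MatBound T C) :
    MatBound (fun i j => (y i j : H₁ →L[ℂ] H₂)) C := by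
  have hn₁ : (atTop : Filter (Finset M₁ × ℕ)).NeBot := by classical exact atTop_neBot
  have hn₂ : (atTop : Filter (Finset M₂ × ℕ)).NeBot := by classical exact atTop_neBot
  have step : ∀ (l₁ : Finset M₁ × ℕ) (l₂ : Finset M₂ × ℕ), MatBound (fun i j =>
      approxUnit l₂ ∘L (y i j : H₁ →L[ℂ] H₂) ∘L approxUnit l₁) C := by
    intro l₁ l₂
    refine MatBound.decompress hC ?_
      (fun u => sum_norm_sq_le_of_norm_sum_le (p := unitRow l₁) (norm_approxUnit_le l₁) u)
      (fun u => sum_norm_sq_le_of_norm_sum_le (p := unitRow l₂) (norm_approxUnit_le l₂) u)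
    let x : ι × l₂.1 → κ × l₁.1 → 𝓔.X := fun i j =>
      ⟨_, hL.mem_left (hL.left.row l₂ i.2).2 (y i.1 j.1).2 (hL.right.row l₁ j.2).2⟩
    have h1 := MatBound.compress hC hTC (hs.sum_norm_row_le hL.right l₁)
      (ht.sum_norm_row_le hL.left l₂)
    have h3 : (fun (i : ι × l₂.1) (j : κ × l₁.1) => t (hL.left.row l₂ i.2) ∘L T i.1 j.1 ∘L
        (s (hL.right.row l₁ j.2))†) = fun i j => r.φ (x i j) := by
      ext1 i; ext1 j
      exact hT i.1 j.1 _ _ (x i j) rfl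
    exact hr.matBound x hC (h3 ▸ h1)
  refine MatBound.of_tendsto (l := atTop) (fun l₁ => MatBound.of_tendsto (l := atTop) (step l₁)
    (S := fun i j => (y i j : H₁ →L[ℂ] H₂) ∘L approxUnit l₁) fun i j v => ?_) fun i j v => ?_
  · have hy : (y i j : H₁ →L[ℂ] H₂) ∘L approxUnit l₁ ∈ 𝓕.X :=
      𝓕.right_mem _ (y i j).2 _ (hL.right.approxUnit_mem l₁)
    exact ((ContinuousLinearMap.apply ℂ H₂ v).continuous.tendsto _).comp
      (hL.tendsto_approxUnit_comp hy)
  · exact ((ContinuousLinearMap.apply ℂ H₂ v).continuous.tendsto _).comp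
      (hL.tendsto_comp_approxUnit (y i j).2)

/-- The completely contractive map of a bimodule map as a continuous linear map. -/
noncomputable def _root_.StrongTRO.BimoduleMap.φCLM (r : BimoduleMap 𝓔) :
    𝓔.X →L[ℂ] (r.L₁ →L[ℂ] r.L₂) :=
  r.φ.mkContinuous 1 fun x => by simpa using r.completelyContractive.norm_le x

/-- The map induced on `𝓕.X`. -/
theorem exists_right_map (hL : Linked 𝓔 𝓕 M₁ M₂) (hs : IsInduced r.σ s) (ht : IsInduced r.π t) :
    ∃ ψ : 𝓕.X →ₗ[ℂ] (L₁' →L[ℂ] L₂'), ∀ (n : M₂) (m : M₁) (y : 𝓕.X) (x : 𝓔.X),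
      (x : K₁ →L[ℂ] K₂) = (n : H₂ →L[ℂ] K₂) ∘L (y : H₁ →L[ℂ] H₂) ∘L (m : H₁ →L[ℂ] K₁)† →
        t n ∘L ψ y ∘L (s m)† = r.φ x := by
  let Θ : M₂ × M₁ → (L₁' →L[ℂ] L₂') →L[ℂ] (r.L₁ →L[ℂ] r.L₂) := fun j =>
    ContinuousLinearMap.compL ℂ r.L₁ L₂' r.L₂ (t j.1) ∘L
      (ContinuousLinearMap.compL ℂ r.L₁ L₁' L₂').flip ((s j.2)†)
  let f : M₂ × M₁ → 𝓕.X →L[ℂ] (r.L₁ →L[ℂ] r.L₂) := fun j =>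
    r.φCLM ∘L sandwich 𝓕.X 𝓔.X j.1 ((j.2 : H₁ →L[ℂ] K₁)†)
      fun y hy => hL.mem_left j.1.2 hy j.2.2
  have hf : ∀ j y, f j y = r.φ ⟨_, hL.mem_left j.1.2 y.2 j.2.2⟩ := fun _ _ => rfl
  have hΘ : ∀ j T, Θ j T = t j.1 ∘L T ∘L (s j.2)† := fun _ _ => rfl
  obtain ⟨F, hF⟩ := exists_linearMap_of_equations hL.eq_right Θ f
    (fun y T h => by
      refine (matBound_unique_iff (ι := Fin 1) _ (norm_nonneg _)).1 ?_
      refine hL.matBound_of_compression hs ht (y := fun _ _ => y) (fun _ _ n m x hx => ?_)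
        (norm_nonneg _) ((matBound_unique_iff (y : H₁ →L[ℂ] H₂) (norm_nonneg _)).2 le_rfl)
      have := h (n, m)
      rw [hf, hΘ] at this
      rw [this]; congr 1; exact Subtype.ext hx.symm)
    (by
      rintro ⟨y, hy'⟩ ⟨n, hn, x, hx, m, hm, rfl⟩
      -- For `y = n* x m` the value is forced by the required formula for `ψ`; the bimodule property
      -- of `φ` verifies the equations.
      refine ⟨(t ⟨n, hn⟩)† ∘L r.φ ⟨x, hx⟩ ∘L s ⟨m, hm⟩, fun j => ?_⟩
      rw [hΘ, hf]
      have h1 := ht.mul j.1 ⟨n, hn⟩ ⟨_, hL.left.left_mem j.1.2 hn⟩ rfl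
      have h2 := hs.mul ⟨m, hm⟩ j.2 ⟨_, hL.right.left_mem hm j.2.2⟩ rfl
      calc _ = (t j.1 ∘L (t ⟨n, hn⟩)†) ∘L (r.φ ⟨x, hx⟩ ∘L (s ⟨m, hm⟩ ∘L (s j.2)†)) := rfl
        _ = _ := by
          rw [h1, h2, ← r.map_right, ← r.map_left]; rfl)
  refine ⟨F, fun n m y x hx => ?_⟩
  have := hF (n, m) y
  rw [hf, hΘ] at this
  rw [this]; congr 1; exact Subtype.ext hx.symm

end Transfer

end Linked

end Linked

/-! ### Pairs of representations linked by a representation of the TRO -/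

section Implements

variable {H K L L' : Type*}
  [NormedAddCommGroup H] [InnerProductSpace ℂ H] [CompleteSpace H]
  [NormedAddCommGroup K] [InnerProductSpace ℂ K] [CompleteSpace K]
  [NormedAddCommGroup L] [InnerProductSpace ℂ L] [CompleteSpace L]
  [NormedAddCommGroup L'] [InnerProductSpace ℂ L'] [CompleteSpace L']
  {M : Submodule ℂ (H →L[ℂ] K)} {B : NonUnitalStarSubalgebra ℂ (K →L[ℂ] K)}
  {D : NonUnitalStarSubalgebra ℂ (H →L[ℂ] H)}

/-- The representations `σ` of `[M M*]` and `τ` of `[M* M]` are linked by `s`, a representation of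
the TRO `M`. -/
structure Implements (σ : B →⋆ₙₐ[ℂ] (L →L[ℂ] L)) (τ : D →⋆ₙₐ[ℂ] (L' →L[ℂ] L'))
    (s : M →ₗ[ℂ] (L' →L[ℂ] L)) : Prop where
  left : ∀ (m n : M) (b : B), (b : K →L[ℂ] K) = m ∘L (n : H →L[ℂ] K)† → s m ∘L (s n)† = σ b
  right : ∀ (m n : M) (d : D), (d : H →L[ℂ] H) = (m : H →L[ℂ] K)† ∘L n → (s m)† ∘L s n = τ d

/-- The linear map `m* ↦ (s m)*`. -/
noncomputable def adjointMap (s : M →ₗ[ℂ] (L' →L[ℂ] L)) :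
    adjointTRO M →ₗ[ℂ] (L →L[ℂ] L') where
  toFun T := (s ⟨(T : K →L[ℂ] H)†, T.2⟩)†
  map_add' S T := by
    rw [← map_add, ← map_add]
    congr 2
    exact Subtype.ext (map_add (ContinuousLinearMap.adjoint (𝕜 := ℂ)) (S : K →L[ℂ] H) T)
  map_smul' c T := by
    have : (⟨((c • T : adjointTRO M) : K →L[ℂ] H)†, (c • T).2⟩ : M) =
        starRingEnd ℂ c • ⟨(T : K →L[ℂ] H)†, T.2⟩ := Subtype.ext (by simp [map_smulₛₗ])
    rw [this, map_smul, map_smulₛₗ]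
    simp

theorem adjointMap_apply (s : M →ₗ[ℂ] (L' →L[ℂ] L)) (T : adjointTRO M) :
    adjointMap s T = (s ⟨(T : K →L[ℂ] H)†, T.2⟩)† := rfl

variable {σ : B →⋆ₙₐ[ℂ] (L →L[ℂ] L)} {τ : D →⋆ₙₐ[ℂ] (L' →L[ℂ] L')}
  {s : M →ₗ[ℂ] (L' →L[ℂ] L)}

theorem TROPair.left_eq (hP : TROPair M B D) : B.toSubmodule = ncl (leftProducts M) :=
  Submodule.ext hP.mem_left

theorem TROPair.right_eq (hP : TROPair M B D) : D.toSubmodule = ncl (rightProducts M) :=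
  Submodule.ext hP.mem_right

omit [CompleteSpace L'] in
/-- A closed subspace contains the vectors `T (σ b ξ)` for all `b ∈ [M M*]` as soon as it does so
for the products `b = m n*`. -/
theorem TROPair.comp_rep_mem (hP : TROPair M B D) (T : L →L[ℂ] L') (ξ : L) {V : Submodule ℂ L'}
    (hV : IsClosed (V : Set L'))
    (h : ∀ (m n : M) (b : B), (b : K →L[ℂ] K) = m ∘L (n : H →L[ℂ] K)† → T (σ b ξ) ∈ V) (b : B) :
    T (σ b ξ) ∈ V := by
  let f : B.toSubmodule →L[ℂ] L' :=
    T ∘L ContinuousLinearMap.apply ℂ L ξ ∘L repCLM hP.isClosed_left σ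
  have := eq_top_of_forall_mem hP.left_eq (W := V.comap (f : B.toSubmodule →ₗ[ℂ] L'))
    (hV.preimage f.continuous) (by
      rintro b ⟨m, hm, n, hn, hb⟩
      exact h ⟨m, hm⟩ ⟨n, hn⟩ ⟨b.1, b.2⟩ hb)
  have hb : (⟨b.1, b.2⟩ : B.toSubmodule) ∈ V.comap (f : B.toSubmodule →ₗ[ℂ] L') :=
    this ▸ Submodule.mem_top
  exact hb

namespace Implements

theorem symm (h : Implements σ τ s) : Implements τ σ (adjointMap s) where
  left S T d hd := by
    rw [adjointMap_apply, adjointMap_apply, ContinuousLinearMap.adjoint_adjoint]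
    exact h.right _ _ d (by simp [hd])
  right S T b hb := by
    rw [adjointMap_apply, adjointMap_apply, ContinuousLinearMap.adjoint_adjoint]
    exact h.left _ _ b (by simp [hb])

/-- For `d = p* q` this is `σ (m p*) σ (q n*) = σ (m p* q n*)`; continuity extends it to all of `D`.
-/
theorem compression (hP : TROPair M B D) (h : Implements σ τ s) (m n : M) (d : D) (b : B)
    (hb : (b : K →L[ℂ] K) = m ∘L (d : H →L[ℂ] H) ∘L (n : H →L[ℂ] K)†) :
    s m ∘L τ d ∘L (s n)† = σ b := by
  let f : D.toSubmodule →L[ℂ] (L →L[ℂ] L) :=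
    (ContinuousLinearMap.compL ℂ L L' L (s m) ∘L
      (ContinuousLinearMap.compL ℂ L L' L').flip ((s n)†)) ∘L repCLM hP.isClosed_right τ
  let g : D.toSubmodule →L[ℂ] (L →L[ℂ] L) :=
    repCLM hP.isClosed_left σ ∘L sandwich D.toSubmodule B.toSubmodule m ((n : H →L[ℂ] K)†)
      fun d hd => hP.sandwich_mem m.2 n.2 hd
  have hfg : f = g := ext_of_eq_ncl hP.right_eq (by
    rintro ⟨d, hd⟩ ⟨p, hp, q, hq, rfl⟩
    have h1 := h.left m ⟨p, hp⟩ ⟨_, hP.left_mem m.2 hp⟩ rfl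
    have h2 := h.left ⟨q, hq⟩ n ⟨_, hP.left_mem hq n.2⟩ rfl
    change s m ∘L τ ⟨p† ∘L q, hd⟩ ∘L (s n)† = σ ⟨_, hP.sandwich_mem m.2 n.2 hd⟩
    rw [← h.right ⟨p, hp⟩ ⟨q, hq⟩ _ rfl]
    calc _ = (s m ∘L (s ⟨p, hp⟩)†) ∘L (s ⟨q, hq⟩ ∘L (s n)†) := rfl
      _ = _ := by
        rw [h1, h2, ← ContinuousLinearMap.mul_def, ← map_mul]; rfl)
  have h3 : s m ∘L τ d ∘L (s n)† = σ ⟨_, hP.sandwich_mem m.2 n.2 d.2⟩ :=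
    DFunLike.congr_fun hfg ⟨d.1, d.2⟩
  rw [h3]; congr 1; exact Subtype.ext hb.symm

/-- Since `τ (p* q) = (s p)* s q`, non-degeneracy of `τ` makes the ranges of the `(s m)*` dense. So
`L'` must be the induced space. -/
theorem isInduced (hP : TROPair M B D) (h : Implements σ τ s)
    (hτ : DenseRanges fun d => τ d) : IsInduced σ s where
  mul := h.left
  dense := by
    refine hτ.of_forall_mem (isClosed_ncl _) fun d ξ => ?_
    refine hP.symm.comp_rep_mem (σ := τ) (.id ℂ L') ξ (isClosed_ncl _) (fun m n d hd => ?_) d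
    have h1 := h.right ⟨(m : K →L[ℂ] H)†, m.2⟩ ⟨(n : K →L[ℂ] H)†, n.2⟩ d (by simp [hd])
    rw [← h1]
    exact subset_ncl ⟨_, _, rfl⟩

/-- If `σ` is faithful, so is `τ`. -/
theorem injective_right (hP : TROPair M B D) (h : Implements σ τ s)
    (hσ : Function.Injective σ) : Function.Injective τ := by
  rw [injective_iff_map_eq_zero]
  intro d hd
  have h1 : ∀ m n : M, (m : H →L[ℂ] K) ∘L (d : H →L[ℂ] H) ∘L (n : H →L[ℂ] K)† = 0 := by
    intro m n
    have h2 := h.compression hP m n d ⟨_, hP.sandwich_mem m.2 n.2 d.2⟩ rfl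
    rw [hd, ContinuousLinearMap.zero_comp, ContinuousLinearMap.comp_zero] at h2
    exact congrArg Subtype.val ((injective_iff_map_eq_zero σ).1 hσ _ h2.symm)
  have h3 : ∀ m : M, (m : H →L[ℂ] K) ∘L (d : H →L[ℂ] H) = 0 := by
    intro m
    -- Taking `n = m d` gives `(m d)(m d)* = 0`.
    have h4 := h1 m ⟨_, hP.comp_right_mem m.2 d.2⟩
    rw [ContinuousLinearMap.adjoint_comp, ← ContinuousLinearMap.comp_assoc,
      ← ContinuousLinearMap.comp_assoc] at h4
    have h5 : ((m : H →L[ℂ] K) ∘L (d : H →L[ℂ] H)) ∘L ((m : H →L[ℂ] K) ∘L (d : H →L[ℂ] H))† = 0 := by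
      rw [ContinuousLinearMap.adjoint_comp, ← ContinuousLinearMap.comp_assoc]; exact h4
    have h6 : (((m : H →L[ℂ] K) ∘L (d : H →L[ℂ] H))†) = 0 :=
      ContinuousLinearMap.adjoint_comp_self_eq_zero_iff.1
        (by rwa [ContinuousLinearMap.adjoint_adjoint])
    rw [← ContinuousLinearMap.adjoint_adjoint ((m : H →L[ℂ] K) ∘L (d : H →L[ℂ] H)), h6, map_zero]
  have h7 : ∀ e ∈ ncl (rightProducts M), e ∘L (d : H →L[ℂ] H) = 0 := by
    intro e he
    refine comp_mem_of_ncl (S := rightProducts M) (T := {(d : H →L[ℂ] H)}) (U := ⊥)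
      (by simp) ?_ he (subset_ncl rfl)
    rintro _ ⟨m, hm, n, hn, rfl⟩ _ rfl
    rw [Submodule.mem_bot, ContinuousLinearMap.comp_assoc, h3 ⟨n, hn⟩,
      ContinuousLinearMap.comp_zero]
  have h8 := h7 _ ((hP.mem_right _).1 (star_mem d.2))
  apply Subtype.ext
  exact ContinuousLinearMap.adjoint_comp_self_eq_zero_iff.1 h8

end Implements

/-- Compressed between `s m` and `(s n)*`, both `(s p)* s q` and `τ (p* q)` become `σ (m p*) σ (q
n*)`. -/
theorem IsInduced.implements (hP : TROPair M B D) (hs : IsInduced σ s)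
    (hτ : ∀ (m n : M) (d : D) (b : B),
      (b : K →L[ℂ] K) = m ∘L (d : H →L[ℂ] H) ∘L (n : H →L[ℂ] K)† →
        s m ∘L τ d ∘L (s n)† = σ b) : Implements σ τ s where
  left := hs.mul
  right p q d hd := by
    refine hs.dense.ext fun n => hs.dense.ext_left fun m => ?_
    have h1 := hs.mul m p ⟨_, hP.left_mem m.2 p.2⟩ rfl
    have h2 := hs.mul q n ⟨_, hP.left_mem q.2 n.2⟩ rfl
    rw [ContinuousLinearMap.adjoint_adjoint, hτ m n d
      (⟨_, hP.left_mem m.2 p.2⟩ * ⟨_, hP.left_mem q.2 n.2⟩) (by rw [hd]; rfl), map_mul, ← h1, ← h2]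
    rfl

/-- The point is `(s m)* σ (p q*) ξ = τ (m* p) (s q)* ξ`, with vectors `σ (p q*) ξ` spanning `L`
densely. -/
theorem Implements.dense_right_of_dense_left (hP : TROPair M B D) (h : Implements σ τ s)
    (hs : IsInduced σ s) (hσ : DenseRanges fun b => σ b) : DenseRanges fun d => τ d := by
  refine hs.dense.of_forall_mem (isClosed_ncl _) fun m ξ => ?_
  have hV := hσ.of_forall_mem (V := (ncl {η | ∃ d ξ, η = τ d ξ}).comap ((s m)† : L →ₗ[ℂ] L'))
    ((isClosed_ncl _).preimage ((s m)†).continuous) fun b ξ => by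
      refine hP.comp_rep_mem ((s m)†) ξ (isClosed_ncl _) (fun p q b hb => ?_) b
      rw [← h.left p q b hb]
      exact subset_ncl ⟨⟨_, hP.right_mem m.2 p.2⟩, ((s q)†) ξ,
        DFunLike.congr_fun (h.right m p ⟨_, hP.right_mem m.2 p.2⟩ rfl) (((s q)†) ξ)⟩
  have : ξ ∈ (ncl {η | ∃ d ξ, η = τ d ξ}).comap ((s m)† : L →ₗ[ℂ] L') := hV ▸ Submodule.mem_top
  exact this

end Implements

/-! ### Existence, uniqueness and symmetry of corresponding bimodule maps -/

section Links

variable {H₁ H₂ K₁ K₂ : Type u}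
  [NormedAddCommGroup H₁] [InnerProductSpace ℂ H₁] [CompleteSpace H₁]
  [NormedAddCommGroup H₂] [InnerProductSpace ℂ H₂] [CompleteSpace H₂]
  [NormedAddCommGroup K₁] [InnerProductSpace ℂ K₁] [CompleteSpace K₁]
  [NormedAddCommGroup K₂] [InnerProductSpace ℂ K₂] [CompleteSpace K₂]
  {𝓔 : CStarBimodule K₁ K₂} {𝓕 : CStarBimodule H₁ H₂}
  {M₁ : Submodule ℂ (H₁ →L[ℂ] K₁)} {M₂ : Submodule ℂ (H₂ →L[ℂ] K₂)}

/-- The bimodule maps `r` and `r'` correspond to each other via the TRO representations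
`s` and `t`. -/
structure Links (r : BimoduleMap 𝓔) (r' : BimoduleMap 𝓕) (s : M₁ →ₗ[ℂ] (r'.L₁ →L[ℂ] r.L₁))
    (t : M₂ →ₗ[ℂ] (r'.L₂ →L[ℂ] r.L₂)) : Prop where
  right : Implements r.σ r'.σ s
  left : Implements r.π r'.π t
  map : ∀ (n : M₂) (x : 𝓔.X) (m : M₁) (y : 𝓕.X), (y : H₁ →L[ℂ] H₂) =
    (n : H₂ →L[ℂ] K₂)† ∘L (x : K₁ →L[ℂ] K₂) ∘L (m : H₁ →L[ℂ] K₁) →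
      r'.φ y = (t n)† ∘L r.φ x ∘L s m

variable (M₁ M₂) in
/-- `r` and `r'` correspond to each other via some TRO representations. -/
def Linkable (r : BimoduleMap 𝓔) (r' : BimoduleMap 𝓕) : Prop :=
  ∃ (s : M₁ →ₗ[ℂ] (r'.L₁ →L[ℂ] r.L₁)) (t : M₂ →ₗ[ℂ] (r'.L₂ →L[ℂ] r.L₂)), Links r r' s t

variable {r : BimoduleMap 𝓔} {r' r'' : BimoduleMap 𝓕}

theorem IsInduced.comp_right {H K L L' : Type*}
    [NormedAddCommGroup H] [InnerProductSpace ℂ H] [CompleteSpace H]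
    [NormedAddCommGroup K] [InnerProductSpace ℂ K] [CompleteSpace K]
    [NormedAddCommGroup L] [InnerProductSpace ℂ L] [CompleteSpace L]
    [NormedAddCommGroup L'] [InnerProductSpace ℂ L'] [CompleteSpace L']
    {M : Submodule ℂ (H →L[ℂ] K)} {B : NonUnitalStarSubalgebra ℂ (K →L[ℂ] K)}
    {D : NonUnitalStarSubalgebra ℂ (H →L[ℂ] H)} {σ : B →⋆ₙₐ[ℂ] (L →L[ℂ] L)}
    {s : M →ₗ[ℂ] (L' →L[ℂ] L)} (hP : TROPair M B D) (hs : IsInduced σ s) {d : H →L[ℂ] H}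
    (hd : d ∈ D) {T : L' →L[ℂ] L'} (hT : ∀ (m n : M) (b : B),
      (b : K →L[ℂ] K) = m ∘L d ∘L (n : H →L[ℂ] K)† → s m ∘L T ∘L (s n)† = σ b)
    (m : M) : s m ∘L T = s ⟨_, hP.comp_right_mem m.2 hd⟩ :=
  hs.dense.ext fun n => by
    rw [hs.mul _ n ⟨_, hP.sandwich_mem m.2 n.2 hd⟩ rfl, ContinuousLinearMap.comp_assoc]
    exact hT m n _ rfl

namespace Links

variable {s : M₁ →ₗ[ℂ] (r'.L₁ →L[ℂ] r.L₁)} {t : M₂ →ₗ[ℂ] (r'.L₂ →L[ℂ] r.L₂)}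

/-- On generators `y = n'* x m'` the left side is `π (n n'*) φ(x) σ (m' m*)`. This is the defining
formula with the roles of the two bimodules exchanged, and so yields symmetry of `Links`. -/
theorem compression (hL : Linked 𝓔 𝓕 M₁ M₂) (h : Links r r' s t) (n : M₂) (m : M₁) (y : 𝓕.X)
    (x : 𝓔.X) (hx : (x : K₁ →L[ℂ] K₂) =
      (n : H₂ →L[ℂ] K₂) ∘L (y : H₁ →L[ℂ] H₂) ∘L (m : H₁ →L[ℂ] K₁)†) :
    t n ∘L r'.φ y ∘L (s m)† = r.φ x := by
  let f : 𝓕.X →L[ℂ] (r.L₁ →L[ℂ] r.L₂) :=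
    (ContinuousLinearMap.compL ℂ r.L₁ r'.L₂ r.L₂ (t n) ∘L
      (ContinuousLinearMap.compL ℂ r.L₁ r'.L₁ r'.L₂).flip ((s m)†)) ∘L r'.φCLM
  let g : 𝓕.X →L[ℂ] (r.L₁ →L[ℂ] r.L₂) :=
    r.φCLM ∘L sandwich 𝓕.X 𝓔.X n ((m : H₁ →L[ℂ] K₁)†) fun y hy => hL.mem_left n.2 hy m.2
  have hfg : f = g := ext_of_eq_ncl hL.eq_right (by
    rintro ⟨y, hy⟩ ⟨n', hn', x, hx, m', hm', rfl⟩
    change t n ∘L r'.φ ⟨_, hy⟩ ∘L (s m)† = r.φ ⟨_, hL.mem_left n.2 hy m.2⟩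
    rw [h.map ⟨n', hn'⟩ ⟨x, hx⟩ ⟨m', hm'⟩ _ rfl]
    have h1 := h.left.left n ⟨n', hn'⟩ ⟨_, hL.left.left_mem n.2 hn'⟩ rfl
    have h2 := h.right.left ⟨m', hm'⟩ m ⟨_, hL.right.left_mem hm' m.2⟩ rfl
    calc _ = (t n ∘L (t ⟨n', hn'⟩)†) ∘L (r.φ ⟨x, hx⟩ ∘L (s ⟨m', hm'⟩ ∘L (s m)†)) := rfl
      _ = _ := by
        rw [h1, h2, ← r.map_right, ← r.map_left]; rfl)
  have h3 : t n ∘L r'.φ y ∘L (s m)† = r.φ ⟨_, hL.mem_left n.2 y.2 m.2⟩ := DFunLike.congr_fun hfg y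
  rw [h3]; congr 1; exact Subtype.ext hx.symm

theorem symm (hL : Linked 𝓔 𝓕 M₁ M₂) (h : Links r r' s t) :
    Links r' r (adjointMap s) (adjointMap t) where
  right := h.right.symm
  left := h.left.symm
  map n y m x hx := by
    rw [adjointMap_apply, adjointMap_apply, ContinuousLinearMap.adjoint_adjoint]
    exact (h.compression hL _ _ y x (by simpa using hx)).symm

end Links

theorem adjointTRO_adjointTRO {H K : Type*}
    [NormedAddCommGroup H] [InnerProductSpace ℂ H] [CompleteSpace H]
    [NormedAddCommGroup K] [InnerProductSpace ℂ K] [CompleteSpace K]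
    (M : Submodule ℂ (H →L[ℂ] K)) : adjointTRO (adjointTRO M) = M := by
  ext T; simp [mem_adjointTRO]

theorem Linkable.symm (hL : Linked 𝓔 𝓕 M₁ M₂) (h : Linkable M₁ M₂ r r') :
    Linkable (adjointTRO M₁) (adjointTRO M₂) r' r := by
  obtain ⟨s, t, h⟩ := h
  exact ⟨_, _, h.symm hL⟩

theorem linkable_symm_iff (hL : Linked 𝓔 𝓕 M₁ M₂) :
    Linkable (adjointTRO M₁) (adjointTRO M₂) r' r ↔ Linkable M₁ M₂ r r' :=
  ⟨fun h => by simpa only [adjointTRO_adjointTRO] using h.symm hL.symm, fun h => h.symm hL⟩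

/-- Every non-degenerate bimodule map has a corresponding one. -/
theorem Linked.exists_linkable (hL : Linked 𝓔 𝓕 M₁ M₂) (r : BimoduleMap 𝓔)
    (hr : r.NonDegenerate) : ∃ r' : BimoduleMap 𝓕, r'.NonDegenerate ∧ Linkable M₁ M₂ r r' := by
  obtain ⟨L₁', _, _, _, s, hs⟩ := hL.right.exists_isInduced r.σ
  obtain ⟨L₂', _, _, _, t, ht⟩ := hL.left.exists_isInduced r.π
  obtain ⟨τ, hτ⟩ := hs.exists_right_rep hL.right
  obtain ⟨ρ, hρ⟩ := ht.exists_right_rep hL.left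
  obtain ⟨ψ, hψ⟩ := hL.exists_right_map hs ht
  have hright := hs.implements hL.right hτ
  have hleft := ht.implements hL.left hρ
  have ext' : ∀ {S T : L₁' →L[ℂ] L₂'},
      (∀ (n : M₂) (m : M₁), t n ∘L S ∘L (s m)† = t n ∘L T ∘L (s m)†) → S = T := fun {S T} h =>
    hs.dense.ext fun m => ht.dense.ext_left fun n => by
      simpa only [ContinuousLinearMap.adjoint_adjoint] using h n m
  let r' : BimoduleMap 𝓕 :=
    { L₁ := L₁'
      L₂ := L₂'
      π := ρ
      φ := ψ
      σ := τ
      completelyContractive := completelyContractive_iff.2 fun n y C hC hy =>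
        hL.matBound_of_compression hs ht (fun i j n m x hx => hψ n m (y i j) x hx) hC hy
      map_left := fun c y => ext' fun n m => by
        -- The factor `ρ c` is absorbed as `t n ρ(c) = t (n c)`; on the other side `τ d` is absorbed
        -- into `(s m)*`.
        have h1 := ht.comp_right hL.left c.2 (fun m n b hb => hρ m n c b hb) n
        have h2 : t n ∘L (ρ c ∘L ψ y) ∘L (s m)† = (t n ∘L ρ c) ∘L ψ y ∘L (s m)† := rfl
        rw [hψ n m _ ⟨_, hL.mem_left n.2 (𝓕.left_mem c c.2 y y.2) m.2⟩ rfl, h2, h1]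
        exact (hψ _ _ _ _ rfl).symm
      map_right := fun y d => ext' fun n m => by
        have hd : (d : H₁ →L[ℂ] H₁)† ∈ 𝓕.B := star_mem (s := 𝓕.B) d.2
        have h1 := hs.comp_adjoint hL.right d.2 (fun m n b hb => hτ m n d b hb) m
            ⟨_, hL.right.comp_right_mem m.2 hd⟩ rfl
        have h2 : t n ∘L (ψ y ∘L τ d) ∘L (s m)† = t n ∘L ψ y ∘L (τ d ∘L (s m)†) := rfl
        rw [hψ n m _ ⟨_, hL.mem_left n.2 (𝓕.right_mem y y.2 d d.2) m.2⟩ rfl, h2, h1]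
        refine (hψ _ _ _ _ ?_).symm
        simp [ContinuousLinearMap.adjoint_comp, ContinuousLinearMap.comp_assoc] }
  have hlinks : Links r r' s t :=
    { right := hright
      left := hleft
      map := fun n x m y hy => ext' fun n' m' => by
        have h1 := ht.mul n' n ⟨_, hL.left.left_mem n'.2 n.2⟩ rfl
        have h2 := hs.mul m m' ⟨_, hL.right.left_mem m.2 m'.2⟩ rfl
        have h3 : t n' ∘L ((t n)† ∘L r.φ x ∘L s m) ∘L (s m')† =
            (t n' ∘L (t n)†) ∘L (r.φ x ∘L (s m ∘L (s m')†)) := rfl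
        rw [h3, h1, h2, ← r.map_right, ← r.map_left]
        refine hψ n' m' y _ ?_
        rw [hy]
        rfl }
  refine ⟨r', ⟨?_, ?_, ?_, ?_⟩, s, t, hlinks⟩
  · exact hleft.dense_right_of_dense_left hL.left ht hr.left
  · refine ht.dense.of_forall_mem (isClosed_ncl _) fun n ξ => ?_
    set V : Submodule ℂ L₂' := ncl {η | ∃ (y : 𝓕.X) (ξ : L₁'), η = ψ y ξ}
    have hVc : IsClosed (V : Set L₂') := isClosed_ncl _
    have h1 : ∀ (x : 𝓔.X) ζ, ((t n)†) (r.φ x ζ) ∈ V := by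
      intro x ζ
      -- It suffices to treat `σ (m p*) ζ = s m (s p)* ζ`, which `(t n)* φ(x)` sends to `ψ (n* x m)
      -- (s p)* ζ`.
      have h2 := DenseRanges.of_forall_mem (u := fun b => r.σ b) hr.right
        (V := V.comap ((t n)† ∘L r.φ x : r.L₁ →ₗ[ℂ] L₂'))
        (hVc.preimage ((t n)† ∘L r.φ x).continuous) fun b ζ => by
          refine hL.right.comp_rep_mem ((t n)† ∘L r.φ x) ζ hVc (fun m p b hb => ?_) b
          rw [← hs.mul m p b hb]
          exact subset_ncl ⟨⟨_, hL.mem_right n.2 x.2 m.2⟩, ((s p)†) ζ,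
            (DFunLike.congr_fun (hlinks.map n x m _ rfl) (((s p)†) ζ)).symm⟩
      have h3 : ζ ∈ V.comap ((t n)† ∘L r.φ x : r.L₁ →ₗ[ℂ] L₂') := h2 ▸ Submodule.mem_top
      exact h3
    have h4 := DenseRanges.of_forall_mem (u := fun x => r.φ x) hr.range
      (V := V.comap ((t n)† : r.L₂ →ₗ[ℂ] L₂')) (hVc.preimage ((t n)†).continuous) h1
    have h5 : ξ ∈ V.comap ((t n)† : r.L₂ →ₗ[ℂ] L₂') := h4 ▸ Submodule.mem_top
    exact h5
  · refine hs.dense.of_forall_mem (isClosed_ncl _) fun m ξ => ?_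
    set V : Submodule ℂ L₁' := ncl {η | ∃ (y : 𝓕.X) (ξ : L₂'), η = ((ψ y)†) ξ}
    have hVc : IsClosed (V : Set L₁') := isClosed_ncl _
    have h1 : ∀ (x : 𝓔.X) ζ, ((s m)†) (((r.φ x)†) ζ) ∈ V := by
      intro x ζ
      -- Dually, `(s m)* φ(x)* π (n p*) = ψ (n* x m)* (t p)*`.
      have h2 := DenseRanges.of_forall_mem (u := fun a => r.π a) hr.left
        (V := V.comap ((s m)† ∘L (r.φ x)† : r.L₂ →ₗ[ℂ] L₁'))
        (hVc.preimage ((s m)† ∘L (r.φ x)†).continuous) fun a ζ => by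
          refine hL.left.comp_rep_mem ((s m)† ∘L (r.φ x)†) ζ hVc (fun n p a ha => ?_) a
          rw [← ht.mul n p a ha]
          refine subset_ncl ⟨⟨_, hL.mem_right n.2 x.2 m.2⟩, ((t p)†) ζ, ?_⟩
          have h6 := hlinks.map n x m ⟨_, hL.mem_right n.2 x.2 m.2⟩ rfl
          have h7 : (ψ ⟨_, hL.mem_right n.2 x.2 m.2⟩)† = (s m)† ∘L (r.φ x)† ∘L t n := by
            rw [show ψ ⟨_, hL.mem_right n.2 x.2 m.2⟩ = _ from h6]
            simp [ContinuousLinearMap.adjoint_comp, ContinuousLinearMap.comp_assoc]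
          rw [h7]
          rfl
      have h3 : ζ ∈ V.comap ((s m)† ∘L (r.φ x)† : r.L₂ →ₗ[ℂ] L₁') := h2 ▸ Submodule.mem_top
      exact h3
    have h4 := DenseRanges.of_forall_mem (u := fun x => (r.φ x)†) hr.corange
      (V := V.comap ((s m)† : r.L₁ →ₗ[ℂ] L₁')) (hVc.preimage ((s m)†).continuous) h1
    have h5 : ξ ∈ V.comap ((s m)† : r.L₁ →ₗ[ℂ] L₁') := h4 ▸ Submodule.mem_top
    exact h5
  · exact hright.dense_right_of_dense_left hL.right hs hr.right

/-- Corresponding bimodule maps are unique up to unitary equivalence. -/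
theorem Linkable.unitarilyEquivalent (hL : Linked 𝓔 𝓕 M₁ M₂) (h' : Linkable M₁ M₂ r r')
    (h'' : Linkable M₁ M₂ r r'') (hr' : r'.NonDegenerate) (hr'' : r''.NonDegenerate) :
    r'.UnitarilyEquivalent r'' := by
  obtain ⟨s, t, h⟩ := h'
  obtain ⟨s', t', h'⟩ := h''
  have hs := h.right.isInduced hL.right hr'.right
  have hs' := h'.right.isInduced hL.right hr''.right
  have ht := h.left.isInduced hL.left hr'.left
  have ht' := h'.left.isInduced hL.left hr''.left
  -- Both families of adjoints have Gram operators `σ (m n*)`, which produces a unitary `V` with `V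
  -- (s m)* = (s' m)*`; `U` arises likewise from `π`.
  obtain ⟨V, hV⟩ := hs.dense.exists_unitary hs'.dense fun m n => by
    simp only [ContinuousLinearMap.adjoint_adjoint]
    rw [h.right.left m n ⟨_, hL.right.left_mem m.2 n.2⟩ rfl,
      h'.right.left m n ⟨_, hL.right.left_mem m.2 n.2⟩ rfl]
  obtain ⟨U, hU⟩ := ht.dense.exists_unitary ht'.dense fun m n => by
    simp only [ContinuousLinearMap.adjoint_adjoint]
    rw [h.left.left m n ⟨_, hL.left.left_mem m.2 n.2⟩ rfl,
      h'.left.left m n ⟨_, hL.left.left_mem m.2 n.2⟩ rfl]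
  let Vc : r'.L₁ →L[ℂ] r''.L₁ := V.toContinuousLinearEquiv
  let Uc : r'.L₂ →L[ℂ] r''.L₂ := U.toContinuousLinearEquiv
  have hVc : ∀ m, Vc ∘L (s m)† = (s' m)† := fun m => ContinuousLinearMap.ext (hV m)
  have hUc : ∀ n, Uc ∘L (t n)† = (t' n)† := fun n => ContinuousLinearMap.ext (hU n)
  have hUt : ∀ n, t' n ∘L Uc = t n := fun n => by
    ext ξ
    refine ext_inner_left ℂ fun η => ?_
    rw [ContinuousLinearMap.comp_apply, ← ContinuousLinearMap.adjoint_inner_left, ← hUc,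
      ← ContinuousLinearMap.adjoint_inner_left (t n)]
    exact U.inner_map_map _ _
  refine ⟨V, U, ?_, ?_, ?_⟩
  · have : ∀ c, r''.π c ∘L Uc = Uc ∘L r'.π c := fun c => ht.dense.ext fun n => by
      have hc : (c : H₂ →L[ℂ] H₂)† ∈ 𝓕.A := star_mem (s := 𝓕.A) c.2
      rw [ContinuousLinearMap.comp_assoc, hUc, ContinuousLinearMap.comp_assoc,
        ht.comp_adjoint hL.left c.2 (fun m n b hb => h.left.compression hL.left m n c b hb) n
          ⟨_, hL.left.comp_right_mem n.2 hc⟩ rfl,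
        ht'.comp_adjoint hL.left c.2 (fun m n b hb => h'.left.compression hL.left m n c b hb) n
          ⟨_, hL.left.comp_right_mem n.2 hc⟩ rfl, hUc]
    intro c ξ
    have h1 := DFunLike.congr_fun (this c) (U.symm ξ)
    simpa [Uc] using h1
  -- After compression by `t' n` and `(s m)*`, both sides equal `φ (n y m*)`.
  · have : ∀ y, r''.φ y ∘L Vc = Uc ∘L r'.φ y := fun y => hs.dense.ext fun m =>
      ht'.dense.ext_left fun n => by
        rw [ContinuousLinearMap.adjoint_adjoint, ContinuousLinearMap.comp_assoc, hVc,
          ContinuousLinearMap.comp_assoc, ← ContinuousLinearMap.comp_assoc (t' n) Uc, hUt,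
          h.compression hL n m y ⟨_, hL.mem_left n.2 y.2 m.2⟩ rfl,
          h'.compression hL n m y ⟨_, hL.mem_left n.2 y.2 m.2⟩ rfl]
    intro y ξ
    have h1 := DFunLike.congr_fun (this y) (V.symm ξ)
    simpa [Uc, Vc] using h1
  · have : ∀ d, r''.σ d ∘L Vc = Vc ∘L r'.σ d := fun d => hs.dense.ext fun m => by
      have hd : (d : H₁ →L[ℂ] H₁)† ∈ 𝓕.B := star_mem (s := 𝓕.B) d.2
      rw [ContinuousLinearMap.comp_assoc, hVc, ContinuousLinearMap.comp_assoc,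
        hs.comp_adjoint hL.right d.2 (fun m n b hb => h.right.compression hL.right m n d b hb) m
          ⟨_, hL.right.comp_right_mem m.2 hd⟩ rfl,
        hs'.comp_adjoint hL.right d.2 (fun m n b hb => h'.right.compression hL.right m n d b hb) m
          ⟨_, hL.right.comp_right_mem m.2 hd⟩ rfl, hVc]
    intro d ξ
    have h1 := DFunLike.congr_fun (this d) (V.symm ξ)
    simpa [Vc] using h1

/-- If `V`, `U` implement the equivalence, then `s V*` and `t U*` link `r` to the new map. -/
theorem Linkable.trans_right (h : Linkable M₁ M₂ r r') (hU : r'.UnitarilyEquivalent r'') :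
    Linkable M₁ M₂ r r'' := by
  obtain ⟨s, t, h⟩ := h
  obtain ⟨V, U, hπ, hφ, hσ⟩ := hU
  let Vc : r''.L₁ →L[ℂ] r'.L₁ := V.symm.toContinuousLinearEquiv
  let Uc : r''.L₂ →L[ℂ] r'.L₂ := U.symm.toContinuousLinearEquiv
  let Vd : r'.L₁ →L[ℂ] r''.L₁ := V.toContinuousLinearEquiv
  let Ud : r'.L₂ →L[ℂ] r''.L₂ := U.toContinuousLinearEquiv
  have hVad : Vc† = Vd := by
    refine (ContinuousLinearMap.eq_adjoint_iff _ _).2 (fun ξ η => ?_) |>.symm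
    simpa [Vc, Vd] using V.inner_map_map ξ (V.symm η)
  have hUad : Uc† = Ud := by
    refine (ContinuousLinearMap.eq_adjoint_iff _ _).2 (fun ξ η => ?_) |>.symm
    simpa [Uc, Ud] using U.inner_map_map ξ (U.symm η)
  have hVV : Vc ∘L Vd = .id ℂ _ := by ext; simp [Vc, Vd]
  have hUU : Uc ∘L Ud = .id ℂ _ := by ext; simp [Uc, Ud]
  have hπ' : ∀ a, r''.π a = Ud ∘L r'.π a ∘L Uc := fun a => ContinuousLinearMap.ext (hπ a)
  have hφ' : ∀ x, r''.φ x = Ud ∘L r'.φ x ∘L Vc := fun x => ContinuousLinearMap.ext (hφ x)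
  have hσ' : ∀ b, r''.σ b = Vd ∘L r'.σ b ∘L Vc := fun b => ContinuousLinearMap.ext (hσ b)
  let s' : M₁ →ₗ[ℂ] (r''.L₁ →L[ℂ] r.L₁) :=
    ((ContinuousLinearMap.compL ℂ r''.L₁ r'.L₁ r.L₁).flip Vc : _ →ₗ[ℂ] _) ∘ₗ s
  let t' : M₂ →ₗ[ℂ] (r''.L₂ →L[ℂ] r.L₂) :=
    ((ContinuousLinearMap.compL ℂ r''.L₂ r'.L₂ r.L₂).flip Uc : _ →ₗ[ℂ] _) ∘ₗ t
  have hs' : ∀ m, s' m = s m ∘L Vc := fun _ => rfl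
  have ht' : ∀ n, t' n = t n ∘L Uc := fun _ => rfl
  refine ⟨s', t', ⟨?_, ?_⟩, ⟨?_, ?_⟩, ?_⟩
  · intro m n b hb
    rw [hs', hs', ContinuousLinearMap.adjoint_comp, hVad, ← h.right.left m n b hb,
      ContinuousLinearMap.comp_assoc, ← ContinuousLinearMap.comp_assoc Vc, hVV,
      ContinuousLinearMap.id_comp]
  · intro m n d hd
    rw [hs', hs', ContinuousLinearMap.adjoint_comp, hVad, hσ', ← h.right.right m n d hd]
    rfl
  · intro m n b hb
    rw [ht', ht', ContinuousLinearMap.adjoint_comp, hUad, ← h.left.left m n b hb,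
      ContinuousLinearMap.comp_assoc, ← ContinuousLinearMap.comp_assoc Uc, hUU,
      ContinuousLinearMap.id_comp]
  · intro m n d hd
    rw [ht', ht', ContinuousLinearMap.adjoint_comp, hUad, hπ', ← h.left.right m n d hd]
    rfl
  · intro n x m y hy
    rw [hφ', h.map n x m y hy, ht', hs', ContinuousLinearMap.adjoint_comp, hUad]
    rfl

theorem Linkable.isFaithfulCES (hL : Linked 𝓔 𝓕 M₁ M₂) (h : Linkable M₁ M₂ r r')
    (hr' : r'.NonDegenerate) (hf : r.IsFaithfulCES) : r'.IsFaithfulCES := by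
  obtain ⟨s, t, h⟩ := h
  have hs := h.right.isInduced hL.right hr'.right
  have ht := h.left.isInduced hL.left hr'.left
  refine ⟨completelyIsometric_iff.2 fun n y C hC => ⟨fun hy => ?_, fun hy => ?_⟩,
    h.left.injective_right hL.left hf.left_injective,
    h.right.injective_right hL.right hf.right_injective⟩
  · exact hL.matBound_of_isometric hs ht hf.completelyIsometric
      (fun i j n m x hx => h.compression hL n m (y i j) x hx) hC hy
  · exact r'.completelyContractive.matBound y hC hy

end Links

/-- A relation that is total and well defined on classes on both sides is a bijection. -/
theorem exists_quotient_equiv {α β : Type*} (sα : Setoid α) (sβ : Setoid β) (R : α → β → Prop)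
    (total : ∀ a, ∃ b, R a b) (total' : ∀ b, ∃ a, R a b)
    (unique : ∀ {a b b'}, R a b → R a b' → sβ.r b b')
    (unique' : ∀ {a a' b}, R a b → R a' b → sα.r a a')
    (congr : ∀ {a b b'}, R a b → sβ.r b b' → R a b')
    (congr' : ∀ {a a' b}, R a b → sα.r a a' → R a' b) :
    ∃ e : Quotient sα ≃ Quotient sβ, ∀ a b, e (Quotient.mk sα a) = Quotient.mk sβ b ↔ R a b := by
  choose f hf using total
  let F : Quotient sα → Quotient sβ := Quotient.lift (fun a => Quotient.mk sβ (f a))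
    fun a a' haa => Quotient.sound (unique (congr' (hf a) haa) (hf a'))
  have hF : ∀ a b, F (Quotient.mk sα a) = Quotient.mk sβ b ↔ R a b := fun a b =>
    ⟨fun h => congr (hf a) (Quotient.exact h), fun h => Quotient.sound (unique (hf a) h)⟩
  refine ⟨.ofBijective F ⟨?_, ?_⟩, hF⟩
  · intro x x' hx
    induction x using Quotient.inductionOn with | _ a
    induction x' using Quotient.inductionOn with | _ a'
    have h1 : R a (f a') := (hF a (f a')).1 (hx.trans ((hF a' (f a')).2 (hf a')))
    exact Quotient.sound (unique' h1 (hf a'))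
  · intro y
    induction y using Quotient.inductionOn with | _ b
    obtain ⟨a, ha⟩ := total' b
    exact ⟨Quotient.mk sα a, (hF a b).2 ha⟩

/-! ### The correspondence on unitary equivalence classes -/

section Main

variable {H₁ H₂ K₁ K₂ : Type u}
  [NormedAddCommGroup H₁] [InnerProductSpace ℂ H₁] [CompleteSpace H₁]
  [NormedAddCommGroup H₂] [InnerProductSpace ℂ H₂] [CompleteSpace H₂]
  [NormedAddCommGroup K₁] [InnerProductSpace ℂ K₁] [CompleteSpace K₁]
  [NormedAddCommGroup K₂] [InnerProductSpace ℂ K₂] [CompleteSpace K₂]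
  {X : Submodule ℂ (K₁ →L[ℂ] K₂)} {Y : Submodule ℂ (H₁ →L[ℂ] H₂)}
  {M₁ : Submodule ℂ (H₁ →L[ℂ] K₁)} {M₂ : Submodule ℂ (H₂ →L[ℂ] K₂)}

theorem StronglyTROEquivalentBy.linked (h : StronglyTROEquivalentBy X Y M₁ M₂) :
    Linked h.bimoduleX h.bimoduleY M₁ M₂ where
  right := ⟨h.tro₁, fun _ => Iff.rfl, fun _ => Iff.rfl⟩
  left := ⟨h.tro₂, fun _ => Iff.rfl, fun _ => Iff.rfl⟩
  eq_left := h.eq_left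
  eq_right := h.eq_right

theorem StronglyTROEquivalentBy.linkable_iff_corresponds (h : StronglyTROEquivalentBy X Y M₁ M₂)
    (r : BimoduleMap h.bimoduleX) (r' : BimoduleMap h.bimoduleY) :
    Linkable M₁ M₂ r r' ↔ h.Corresponds r r' := by
  constructor
  · rintro ⟨s, t, hl⟩
    exact ⟨s, t, fun m n => hl.right.left m n _ rfl, fun m n => hl.right.right m n _ rfl,
      fun m n => hl.left.left m n _ rfl, fun m n => hl.left.right m n _ rfl,
      fun n x m => hl.map n x m _ rfl⟩
  · rintro ⟨s, t, h₁, h₂, h₃, h₄, h₅⟩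
    refine ⟨s, t, ⟨fun m n b hb => ?_, fun m n d hd => ?_⟩,
      ⟨fun m n b hb => ?_, fun m n d hd => ?_⟩, fun n x m y hy => ?_⟩
    · rw [h₁]; congr 1; exact Subtype.ext hb.symm
    · rw [h₂]; congr 1; exact Subtype.ext hd.symm
    · rw [h₃]; congr 1; exact Subtype.ext hb.symm
    · rw [h₄]; congr 1; exact Subtype.ext hd.symm
    · refine Eq.trans ?_ (h₅ n x m)
      congr 1; exact Subtype.ext hy

end Main

end StrongTRO

theorem proposition3p6 {H₁ H₂ K₁ K₂ : Type u}
    [NormedAddCommGroup H₁] [InnerProductSpace ℂ H₁] [CompleteSpace H₁]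
    [NormedAddCommGroup H₂] [InnerProductSpace ℂ H₂] [CompleteSpace H₂]
    [NormedAddCommGroup K₁] [InnerProductSpace ℂ K₁] [CompleteSpace K₁]
    [NormedAddCommGroup K₂] [InnerProductSpace ℂ K₂] [CompleteSpace K₂]
    (X : Submodule ℂ (K₁ →L[ℂ] K₂)) (Y : Submodule ℂ (H₁ →L[ℂ] H₂))
    (M₁ : Submodule ℂ (H₁ →L[ℂ] K₁)) (M₂ : Submodule ℂ (H₂ →L[ℂ] K₂))
    (h : StrongTRO.StronglyTROEquivalentBy X Y M₁ M₂) :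
    ∃ e : StrongTRO.NonDegClass h.bimoduleX ≃ StrongTRO.NonDegClass h.bimoduleY,
      (∀ (r : StrongTRO.NonDegMap h.bimoduleX) (r' : StrongTRO.NonDegMap h.bimoduleY),
        e (StrongTRO.NonDegClass.mk r) = StrongTRO.NonDegClass.mk r' ↔
          h.Corresponds r.1 r'.1) ∧
      (∀ (r : StrongTRO.NonDegMap h.bimoduleX) (r' : StrongTRO.NonDegMap h.bimoduleY),
        e (StrongTRO.NonDegClass.mk r) = StrongTRO.NonDegClass.mk r' →
          (r.1.IsFaithfulCES ↔ r'.1.IsFaithfulCES)) := by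
  have hL := h.linked
  obtain ⟨e, he⟩ := StrongTRO.exists_quotient_equiv
    (StrongTRO.unitarySetoid h.bimoduleX) (StrongTRO.unitarySetoid h.bimoduleY)
    (fun r r' => StrongTRO.Linkable M₁ M₂ r.1 r'.1)
    (fun r => by
      obtain ⟨r', hr', hrr'⟩ := hL.exists_linkable r.1 r.2
      exact ⟨⟨r', hr'⟩, hrr'⟩)
    -- Surjectivity is existence for the adjoint TROs, carried back by symmetry.
    (fun r' => by
      obtain ⟨r, hr, hrr'⟩ := hL.symm.exists_linkable r'.1 r'.2
      exact ⟨⟨r, hr⟩, (StrongTRO.linkable_symm_iff hL).1 hrr'⟩)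
    (fun {_ b b'} h₁ h₂ => h₁.unitarilyEquivalent hL h₂ b.2 b'.2)
    (fun {a a' _} h₁ h₂ => (h₁.symm hL).unitarilyEquivalent hL.symm (h₂.symm hL) a.2 a'.2)
    (fun h₁ h₂ => h₁.trans_right h₂)
    (fun h₁ h₂ => (StrongTRO.linkable_symm_iff hL).1 ((h₁.symm hL).trans_right h₂))
  refine ⟨e, fun r r' => (he r r').trans (h.linkable_iff_corresponds r.1 r'.1),
    fun r r' hrr' => ?_⟩
  have hl := (he r r').1 hrr'
  exact ⟨fun hf => hl.isFaithfulCES hL r'.2 hf,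
    fun hf => (hl.symm hL).isFaithfulCES hL.symm r.2 hf⟩
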